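/- Let $G$ be a finite group, $M$ a maximal subgroup of $G$ and $p$ a prime. Then $$h^*(G)-h^*(M)\le 2,\qquad \lambda(G)-\lambda(M)\le 1\qquad\text{and}\qquad \lambda_p(G)-\lambda_p(M)\le 1.$$ Here, for a finite group $X$: (1) $\mathrm F^*(X)$, the generalized Fitting subgroup, is the subgroup generated by all nilpotent normal subgroups of $X$ and all quasisimple subnormal subgroups of $X$ (a group $K$ is quasisimple if it is perfect and $K/Z(K)$ is simple). Put $\mathrm F^*_{(0)}(X)=1$ and let $\mathrm F^*_{(i+1)}(X)$ be the inverse image in $X$ of $\mathrm F^*(X/\mathrm F^*_{(i)}(X))$. The generalized Fitting height $h^*(X)$ is the least $h\ge 0$ with $\mathrm F^*_{(h)}(X)=X$. (2) The non-$p$-soluble length $\lambda_p(X)$ is the least $h\ge 0$ for which there is a series $1=X_0\le X_1\le\dots\le X_{2h+1}=X$ of normal subgroups of $X$ such that, for $0\le i\le 2h$, the factor $X_{i+1}/X_i$ is $p$-soluble (possibly trivial) if $i$ is even, and is a non-empty direct product of nonabelian simple groups if $i$ is odd. (A finite group is $p$-soluble if it has a series of normal subgroups each of whose factors is a $p$-group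 or a group of order prime to $p$.) (3) $\lambda(X)=\lambda_2(X)$ is the nonsoluble length. -/

import Mathlib

namespace GroupLength

universe u

/-- The Fitting subgroup: the subgroup generated by all nilpotent normal subgroups. -/
def fittingSubgroup (G : Type u) [Group G] : Subgroup G :=
  sSup {N : Subgroup G | N.Normal ∧ Group.IsNilpotent N}

/-- A group is quasisimple if it is perfect and its quotient by its centre is simple. -/
def IsQuasisimple (G : Type u) [Group G] : Prop :=
  Group.IsPerfect G ∧ IsSimpleGroup (G ⧸ Subgroup.center G)

/-- The layer: the subgroup generated by all subnormal quasisimple subgroups (the components). -/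
def layer (G : Type u) [Group G] : Subgroup G :=
  sSup {K : Subgroup G | K.IsSubnormal ∧ IsQuasisimple K}

/-- The generalized Fitting subgroup `F*(G)`, generated by the Fitting subgroup and the layer. -/
def generalizedFittingSubgroup (G : Type u) [Group G] : Subgroup G :=
  fittingSubgroup G ⊔ layer G

theorem IsQuasisimple.congr {G H : Type u} [Group G] [Group H] (e : G ≃* H)
    (h : IsQuasisimple G) : IsQuasisimple H := by
  obtain ⟨h1, h2⟩ := h
  refine ⟨Group.IsPerfect.ofSurjective (f := e.toMonoidHom) e.surjective, ?_⟩
  have hc : (Subgroup.center G).map (e : G →* H) = Subgroup.center H := by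
    ext x
    simp only [Subgroup.mem_map, Subgroup.mem_center_iff]
    constructor
    · rintro ⟨y, hy, rfl⟩ g
      have := hy (e.symm g)
      apply e.symm.injective
      simpa using this
    · intro hx
      refine ⟨e.symm x, fun g => ?_, by simp⟩
      apply e.injective
      simpa using hx (e g)
  exact (QuotientGroup.congr _ _ e hc).symm.isSimpleGroup

instance fittingSubgroup_normal (G : Type u) [Group G] : (fittingSubgroup G).Normal := by
  rw [fittingSubgroup, sSup_eq_iSup']
  have : ∀ N : {N : Subgroup G | N.Normal ∧ Group.IsNilpotent N}, (N : Subgroup G).Normal :=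
    fun N => N.2.1
  infer_instance

instance layer_normal (G : Type u) [Group G] : (layer G).Normal := by
  refine ⟨fun n hn g => ?_⟩
  have h : (layer G).map (MulAut.conj g).toMonoidHom ≤ layer G := by
    rw [Subgroup.map_le_iff_le_comap]
    refine sSup_le fun K hK => ?_
    rw [← Subgroup.map_le_iff_le_comap]
    refine le_sSup ⟨?_, ?_⟩
    · exact Subgroup.IsSubnormal.map (f := (MulAut.conj g).toMonoidHom)
        (MulAut.conj g).surjective hK.1
    · exact hK.2.congr
        (K.equivMapOfInjective (MulAut.conj g).toMonoidHom (MulAut.conj g).injective)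
  exact h ⟨n, hn, by simp⟩

instance generalizedFittingSubgroup_normal (G : Type u) [Group G] :
    (generalizedFittingSubgroup G).Normal := by
  unfold generalizedFittingSubgroup
  infer_instance

/-- The terms of the generalized Fitting series, bundled with their normality:
`F*_(0)(G) = 1`, and `F*_(i+1)(G)` is the inverse image of `F*(G / F*_(i)(G))`. -/
def generalizedFittingSeriesAux (G : Type u) [Group G] : ℕ → {N : Subgroup G // N.Normal}
  | 0 => ⟨⊥, inferInstance⟩
  | i + 1 =>
    let F := generalizedFittingSeriesAux G i
    haveI := F.2
    ⟨(generalizedFittingSubgroup (G ⧸ F.1)).comap (QuotientGroup.mk' F.1), inferInstance⟩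

/-- The generalized Fitting series `F*_(i)(G)`. -/
def generalizedFittingSeries (G : Type u) [Group G] (i : ℕ) : Subgroup G :=
  (generalizedFittingSeriesAux G i).1

/-- The generalized Fitting height `h*(G)`: the least `h` with `F*_(h)(G) = G`. Such an `h` exists
for every finite group, see `generalizedFittingSeries_generalizedFittingHeight`. -/
noncomputable def generalizedFittingHeight (G : Type u) [Group G] : ℕ :=
  sInf {h : ℕ | generalizedFittingSeries G h = ⊤}

/-- A group is `p`-soluble if it has a finite series of normal subgroups each of whose factors is
a finite `p`-group or a finite `p'`-group. The order of the factor `N (i + 1) / N i` is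
`(N i).relIndex (N (i + 1))`. (For an infinite factor this is `0`, so a `p`-soluble group is
finite.) -/
def IsPSoluble (p : ℕ) (G : Type u) [Group G] : Prop :=
  ∃ (n : ℕ) (N : ℕ → Subgroup G), (∀ i, (N i).Normal) ∧ Monotone N ∧ N 0 = ⊥ ∧ N n = ⊤ ∧
    ∀ i < n, (∃ k : ℕ, (N i).relIndex (N (i + 1)) = p ^ k) ∨
      ¬ p ∣ (N i).relIndex (N (i + 1))

/-- A group is a (non-empty, finite) direct product of nonabelian simple groups. -/
def IsDirectProductOfNonabelianSimple (G : Type u) [Group G] : Prop :=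
  ∃ (n : ℕ) (S : Fin n → Type u) (_ : ∀ i, Group (S i)),
    0 < n ∧ (∀ i, IsSimpleGroup (S i) ∧ ¬ IsMulCommutative (S i)) ∧ Nonempty (G ≃* ∀ i, S i)

/-- `G` has a series `1 = N 0 ≤ N 1 ≤ ... ≤ N (2 * h + 1) = G` of normal subgroups in which the
factors `N (i + 1) / N i` are alternately `p`-soluble (for even `i`) and non-empty direct products
of nonabelian simple groups (for odd `i`). So there are `h` factors of the second kind. -/
def HasNonPSolubleSeries (p : ℕ) (G : Type u) [Group G] (h : ℕ) : Prop :=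
  ∃ (N : ℕ → Subgroup G) (_ : ∀ i, (N i).Normal), Monotone N ∧ N 0 = ⊥ ∧ N (2 * h + 1) = ⊤ ∧
    ∀ i ≤ 2 * h,
      (Even i → IsPSoluble p (N (i + 1) ⧸ (N i).subgroupOf (N (i + 1)))) ∧
      (Odd i → IsDirectProductOfNonabelianSimple (N (i + 1) ⧸ (N i).subgroupOf (N (i + 1))))

/-- The non-`p`-soluble length `λ_p(G)`: the least `h` for which `G` has a series as in
`HasNonPSolubleSeries`. Such an `h` exists for every finite group, see
`hasNonPSolubleSeries_nonPSolubleLength`. -/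
noncomputable def nonPSolubleLength (p : ℕ) (G : Type u) [Group G] : ℕ :=
  sInf {h : ℕ | HasNonPSolubleSeries p G h}

/-- The nonsoluble length `λ(G) = λ_2(G)`. -/
noncomputable def nonsolubleLength (G : Type u) [Group G] : ℕ :=
  nonPSolubleLength 2 G

/-! Well-definedness of the lengths for finite groups. -/

/-- A finite group without proper nontrivial characteristic subgroups is a direct power of a
simple normal subgroup. -/
theorem exists_mulEquiv_pi_of_characteristicallySimple (N : Type u) [Group N] [Finite N]
    [Nontrivial N] (hN : ∀ K : Subgroup N, K.Characteristic → K = ⊥ ∨ K = ⊤) :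
    ∃ (T : Subgroup N) (n : ℕ), T.Normal ∧ IsSimpleGroup T ∧ 0 < n ∧
      Nonempty (N ≃* (Fin n → T)) := by
  classical
  obtain ⟨T, ⟨hT1, hT2⟩, hmin⟩ := Set.exists_min_image
    {K : Subgroup N | K.Normal ∧ K ≠ ⊥} (fun K => Nat.card K) (Set.toFinite _)
    ⟨⊤, inferInstance, top_ne_bot⟩
  -- the automorphic images of `T` generate `N`
  have hgen : (⨆ φ : N ≃* N, T.map φ.toMonoidHom) = ⊤ := by
    refine (hN _ ?_).resolve_left ?_
    · rw [Subgroup.characteristic_iff_map_le]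
      intro ψ
      rw [Subgroup.map_iSup]
      refine iSup_le fun φ => ?_
      rw [Subgroup.map_map]
      exact le_iSup (fun φ : N ≃* N => T.map φ.toMonoidHom) (φ.trans ψ)
    · intro h
      apply hT2
      have := (le_iSup (fun φ : N ≃* N => T.map φ.toMonoidHom) (MulEquiv.refl N))
      rw [h] at this
      simpa using this
  -- a maximal normal subgroup that is a power of `T`
  obtain ⟨P, ⟨hP1, n, ⟨e⟩⟩, hmax⟩ := Set.exists_max_image
    {P : Subgroup N | P.Normal ∧ ∃ n : ℕ, Nonempty (P ≃* (Fin n → T))}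
    (fun K => Nat.card K) (Set.toFinite _)
    ⟨⊥, inferInstance, 0, ⟨MulEquiv.ofUnique⟩⟩
  have hPtop : P = ⊤ := by
    rw [← top_le_iff, ← hgen]
    refine iSup_le fun φ => ?_
    by_contra hle
    set X := T.map φ.toMonoidHom with hX
    have hXn : X.Normal := hT1.map _ φ.surjective
    let f : T ≃* X := T.equivMapOfInjective φ.toMonoidHom φ.injective
    have hdisj : Disjoint P X := by
      rw [disjoint_iff]
      by_contra hne
      have h1 := hmin (P ⊓ X) ⟨inferInstance, hne⟩
      have h2 : P ⊓ X = X := by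
        apply Subgroup.eq_of_le_of_card_ge inf_le_right
        rw [← Nat.card_congr f.toEquiv]
        exact h1
      exact hle (inf_eq_right.mp h2)
    have hcomm : ∀ (a : P) (b : X), Commute (P.subtype a) (X.subtype b) := fun a b =>
      Subgroup.commute_of_normal_of_disjoint P X hP1 hXn hdisj a b a.2 b.2
    let F := MonoidHom.noncommCoprod P.subtype X.subtype hcomm
    have hF : Function.Injective F := by
      rw [MonoidHom.noncommCoprod_injective]
      refine ⟨P.subtype_injective, X.subtype_injective, ?_⟩
      simpa using hdisj
    have hFr : F.range = P ⊔ X := by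
      rw [MonoidHom.noncommCoprod_range]; simp
    let e' : (P ⊔ X : Subgroup N) ≃* (Fin (n + 1) → T) :=
      (MulEquiv.subgroupCongr hFr).symm.trans <| (MonoidHom.ofInjective hF).symm.trans <|
        (MulEquiv.prodComm.trans (f.symm.prodCongr e)).trans
          { Fin.consEquiv (fun _ : Fin (n + 1) => (T : Type u)) with
            map_mul' := by
              intro a b
              funext i
              refine Fin.cases ?_ (fun i => ?_) i <;> simp [Fin.consEquiv] }
    have h3 := hmax (P ⊔ X) ⟨inferInstance, n + 1, ⟨e'⟩⟩
    have h4 : P = P ⊔ X := Subgroup.eq_of_le_of_card_ge le_sup_left h3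
    exact hle (h4 ▸ le_sup_right)
  subst hPtop
  let E : N ≃* (Fin n → T) := Subgroup.topEquiv.symm.trans e
  have hn : 0 < n := by
    rcases Nat.eq_zero_or_pos n with rfl | h
    · exact absurd E.toEquiv.subsingleton (not_subsingleton N)
    · exact h
  refine ⟨T, n, hT1, ?_, hn, ⟨E⟩⟩
  have : Nontrivial T := (Subgroup.nontrivial_iff_ne_bot T).mpr hT2
  refine ⟨fun H hH => ?_⟩
  by_cases hbot : H = ⊥
  · exact Or.inl hbot
  right
  let i₀ : Fin n := ⟨0, hn⟩
  let j : T →* (Fin n → T) := MonoidHom.mulSingle (fun _ => T) i₀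
  have hj : Function.Injective j := Pi.mulSingle_injective (M := fun _ : Fin n => T) i₀
  let g : T →* N := E.symm.toMonoidHom.comp j
  have hg : Function.Injective g := E.symm.injective.comp hj
  have hnorm : (H.map j).Normal := by
    refine ⟨?_⟩
    rintro _ ⟨t, ht, rfl⟩ x
    refine ⟨x i₀ * t * (x i₀)⁻¹, hH.conj_mem t ht _, ?_⟩
    funext k
    by_cases hk : k = i₀
    · subst hk; simp [j]
    · simp [j, Pi.mulSingle_eq_of_ne hk]
  have h1 := hmin (H.map g) ⟨?_, ?_⟩
  · apply Subgroup.eq_top_of_le_card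
    rwa [Subgroup.card_map_of_injective hg] at h1
  · rw [← Subgroup.map_map]
    exact hnorm.map _ E.symm.surjective
  · rwa [Ne, Subgroup.map_eq_bot_iff_of_injective _ hg]

/-- Every nontrivial finite group has a nontrivial normal subgroup that is a direct power of
a simple group, which can be chosen as a normal subgroup of it. -/
theorem exists_normal_mulEquiv_pi (G : Type u) [Group G] [Finite G] [Nontrivial G] :
    ∃ (N : Subgroup G) (T : Subgroup N) (n : ℕ), N.Normal ∧ T.Normal ∧ IsSimpleGroup T ∧ 0 < n ∧
      Nonempty (N ≃* (Fin n → T)) := by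
  obtain ⟨N, ⟨hN1, hN2⟩, hmin⟩ := Set.exists_min_image
    {K : Subgroup G | K.Normal ∧ K ≠ ⊥} (fun K => Nat.card K) (Set.toFinite _)
    ⟨⊤, inferInstance, top_ne_bot⟩
  have : Nontrivial N := (Subgroup.nontrivial_iff_ne_bot N).mpr hN2
  obtain ⟨T, n, h⟩ := exists_mulEquiv_pi_of_characteristicallySimple N fun K hK => by
    by_cases hbot : K = ⊥
    · exact Or.inl hbot
    right
    have h1 := hmin (K.map N.subtype) ⟨inferInstance, by
      rwa [Ne, Subgroup.map_eq_bot_iff_of_injective _ N.subtype_injective]⟩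
    apply Subgroup.eq_top_of_le_card
    rwa [Subgroup.card_map_of_injective N.subtype_injective] at h1
  exact ⟨N, T, n, hN1, h⟩

theorem generalizedFittingSubgroup_ne_bot (G : Type u) [Group G] [Finite G] [Nontrivial G] :
    generalizedFittingSubgroup G ≠ ⊥ := by
  obtain ⟨N, T, n, hN, hT, hs, hn, ⟨e⟩⟩ := exists_normal_mulEquiv_pi G
  intro hbot
  rw [generalizedFittingSubgroup, sup_eq_bot_iff] at hbot
  obtain ⟨hF, hE⟩ := hbot
  by_cases hc : IsMulCommutative T
  · have hNil : Group.IsNilpotent N := by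
      have hc' : IsMulCommutative N := by
        rw [isMulCommutative_iff] at hc ⊢
        intro a b
        apply e.injective
        funext i
        simpa using hc _ _
      exact ⟨1, by
        rw [Subgroup.upperCentralSeries_one, eq_top_iff]
        exact fun x _ => Subgroup.mem_center_iff.mpr fun y => isMulCommutative_iff.mp hc' y x⟩
    have h1 : N ≤ ⊥ := hF ▸ le_sSup ⟨hN, hNil⟩
    have h2 : Subsingleton N := by
      rw [le_bot_iff] at h1
      subst h1
      infer_instance
    have h3 : Subsingleton T := inferInstance
    exact not_subsingleton T h3
  · have hcen : Subgroup.center T = ⊥ := by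
      refine (Subgroup.Normal.eq_bot_or_eq_top inferInstance).resolve_right fun h => hc ?_
      rw [isMulCommutative_iff]
      intro a b
      exact (Subgroup.mem_center_iff.mp (h ▸ Subgroup.mem_top b : b ∈ Subgroup.center T) a)
    have hq : IsQuasisimple T := by
      refine ⟨⟨(Subgroup.Normal.eq_bot_or_eq_top inferInstance).resolve_left fun h => hc ?_⟩, ?_⟩
      · rw [isMulCommutative_iff]
        intro a b
        have h4 : a * b * a⁻¹ * b⁻¹ ∈ commutator T :=
          Subgroup.commutator_mem_commutator (Subgroup.mem_top a) (Subgroup.mem_top b)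
        rw [h, Subgroup.mem_bot] at h4
        exact (mul_inv_eq_iff_eq_mul.mp (mul_inv_eq_one.mp h4))
      · exact ((QuotientGroup.quotientMulEquivOfEq hcen).trans
          QuotientGroup.quotientBot).isSimpleGroup
    have h1 : T.map N.subtype ≤ ⊥ := hE ▸ le_sSup ⟨hT.isSubnormal.trans' hN.isSubnormal,
      hq.congr (T.equivMapOfInjective N.subtype N.subtype_injective)⟩
    rw [le_bot_iff, Subgroup.map_eq_bot_iff_of_injective _ N.subtype_injective] at h1
    subst h1
    exact not_subsingleton (⊥ : Subgroup N) inferInstance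

theorem exists_generalizedFittingSeries_eq_top (G : Type u) [Group G] [Finite G] :
    ∃ h : ℕ, generalizedFittingSeries G h = ⊤ := by
  by_contra! hne
  have key : ∀ i, i < Nat.card (generalizedFittingSeries G i) := by
    intro i
    induction i with
    | zero => exact Nat.card_pos
    | succ i ih =>
      refine lt_of_le_of_lt (Nat.succ_le_of_lt ih) ?_
      have hi : (generalizedFittingSeries G i).Normal := (generalizedFittingSeriesAux G i).2
      have hnt : Nontrivial (G ⧸ generalizedFittingSeries G i) :=
        QuotientGroup.nontrivial_iff.mpr (hne i)
      have hs : generalizedFittingSeries G (i + 1) =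
        (generalizedFittingSubgroup (G ⧸ generalizedFittingSeries G i)).comap
          (QuotientGroup.mk' _) := rfl
      have hlt : generalizedFittingSeries G i < generalizedFittingSeries G (i + 1) := by
        refine lt_of_le_of_ne ?_ fun heq => ?_
        · rw [hs]
          intro x hx
          rw [Subgroup.mem_comap, QuotientGroup.mk'_apply, (QuotientGroup.eq_one_iff x).mpr hx]
          exact one_mem _
        · apply generalizedFittingSubgroup_ne_bot (G ⧸ generalizedFittingSeries G i)
          rw [← Subgroup.map_comap_eq_self_of_surjective
            (QuotientGroup.mk'_surjective (generalizedFittingSeries G i))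
            (generalizedFittingSubgroup _), ← hs, ← heq]
          simp
      exact Set.Finite.card_lt_card (Set.toFinite _) hlt
  have h1 := key (Nat.card G)
  have h2 := Subgroup.card_le_card_group (generalizedFittingSeries G (Nat.card G))
  omega

theorem generalizedFittingSeries_generalizedFittingHeight (G : Type u) [Group G] [Finite G] :
    generalizedFittingSeries G (generalizedFittingHeight G) = ⊤ :=
  Nat.sInf_mem (exists_generalizedFittingSeries_eq_top G)

theorem IsPSoluble.congr {p : ℕ} {G H : Type u} [Group G] [Group H] (e : G ≃* H)
    (h : IsPSoluble p G) : IsPSoluble p H := by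
  obtain ⟨n, N, h1, h2, h3, h4, h5⟩ := h
  refine ⟨n, fun i => (N i).comap e.symm.toMonoidHom, fun i => inferInstance,
    fun i j hij => Subgroup.comap_mono (h2 hij), ?_, by simp [h4], fun i hi => ?_⟩
  · simpa [h3, MonoidHom.comap_bot] using (MonoidHom.ker_eq_bot_iff _).mpr e.symm.injective
  · rw [Subgroup.relIndex_comap,
      Subgroup.map_comap_eq_self_of_surjective e.symm.surjective]
    exact h5 i hi

theorem IsDirectProductOfNonabelianSimple.congr {G H : Type u} [Group G] [Group H] (e : G ≃* H)
    (h : IsDirectProductOfNonabelianSimple G) : IsDirectProductOfNonabelianSimple H := by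
  obtain ⟨n, S, _, h1, h2, ⟨f⟩⟩ := h
  exact ⟨n, S, inferInstance, h1, h2, ⟨e.symm.trans f⟩⟩

/-- An extension of a `p`-group or `p'`-group by a `p`-soluble group is `p`-soluble. -/
theorem IsPSoluble.of_extension {p : ℕ} {G H : Type u} [Group G] [Group H] (f : G →* H)
    (hf : Function.Surjective f)
    (hk : (∃ k : ℕ, Nat.card f.ker = p ^ k) ∨ ¬ p ∣ Nat.card f.ker) (h : IsPSoluble p H) :
    IsPSoluble p G := by
  obtain ⟨n, N, h1, h2, h3, h4, h5⟩ := h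
  refine ⟨n + 1, fun i => Nat.casesOn i ⊥ fun i => (N i).comap f, ?_,
    monotone_nat_of_le_succ ?_, rfl, by simp [h4], ?_⟩
  · rintro (_ | i)
    · exact (inferInstance : (⊥ : Subgroup G).Normal)
    · exact (h1 i).comap f
  · rintro (_ | i)
    · exact bot_le
    · exact Subgroup.comap_mono (h2 i.le_succ)
  · rintro (_ | i) hi
    · simpa [h3, MonoidHom.comap_bot, Subgroup.relIndex_bot_left] using hk
    · simp only [Subgroup.relIndex_comap, Subgroup.map_comap_eq_self_of_surjective hf]
      exact h5 i (by omega)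

/-- A factor of the inverse images of a series is isomorphic to the factor of that series. -/
theorem nonempty_comap_factor_mulEquiv {G H : Type u} [Group G] [Group H] (f : G →* H)
    (hf : Function.Surjective f) (A B : Subgroup H) [A.Normal] :
    Nonempty (B.comap f ⧸ (A.comap f).subgroupOf (B.comap f) ≃* B ⧸ A.subgroupOf B) := by
  let φ : B.comap f →* B ⧸ A.subgroupOf B :=
    (QuotientGroup.mk' (A.subgroupOf B)).comp (f.subgroupComap B)
  have hφ : Function.Surjective φ := (QuotientGroup.mk'_surjective _).comp
    (f.subgroupComap_surjective_of_surjective B hf)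
  have hker : (A.comap f).subgroupOf (B.comap f) = φ.ker := by
    ext x
    rw [MonoidHom.mem_ker, MonoidHom.comp_apply, QuotientGroup.mk'_apply,
      QuotientGroup.eq_one_iff]
    rfl
  exact ⟨(QuotientGroup.quotientMulEquivOfEq hker).trans
    (QuotientGroup.quotientKerEquivOfSurjective φ hφ)⟩

theorem nonempty_factor_mulEquiv_of_eq_bot {G : Type u} [Group G] (A B : Subgroup G) [A.Normal]
    (hA : A = ⊥) : Nonempty (B ⧸ A.subgroupOf B ≃* B) := by
  subst hA
  exact ⟨(QuotientGroup.quotientMulEquivOfEq (Subgroup.bot_subgroupOf B)).trans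
    QuotientGroup.quotientBot⟩

theorem IsPSoluble.of_subsingleton (p : ℕ) (G : Type u) [Group G] [Subsingleton G] :
    IsPSoluble p G :=
  ⟨0, fun _ => ⊥, fun _ => inferInstance, monotone_const, rfl, Subsingleton.elim _ _,
    fun _ h => absurd h (Nat.not_lt_zero _)⟩

theorem exists_hasNonPSolubleSeries_of_card_le {p : ℕ} (hp : p.Prime) (m : ℕ) :
    ∀ (G : Type u) [Group G] [Finite G], Nat.card G ≤ m → ∃ h : ℕ, HasNonPSolubleSeries p G h := by
  induction m with
  | zero =>
    intro G _ _ hG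
    exact absurd hG (not_le.mpr Nat.card_pos)
  | succ m ih =>
    intro G _ _ hG
    rcases subsingleton_or_nontrivial G with hs | hnt
    · refine ⟨0, fun _ => ⊥, fun _ => inferInstance, monotone_const, rfl, Subsingleton.elim _ _,
        fun i hi => ⟨fun _ => IsPSoluble.of_subsingleton p _, fun hodd => ?_⟩⟩
      obtain rfl : i = 0 := by omega
      exact absurd hodd (by decide)
    obtain ⟨N, T, n, hN, hT, hs, hn, ⟨e⟩⟩ := exists_normal_mulEquiv_pi G
    have hNnt : 1 < Nat.card N := by
      have : Nontrivial (Fin n → T) := by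
        have : Nonempty (Fin n) := ⟨⟨0, hn⟩⟩
        infer_instance
      have := e.toEquiv.nontrivial
      exact Finite.one_lt_card
    have hcard : Nat.card (G ⧸ N) ≤ m := by
      have h1 := Subgroup.card_eq_card_quotient_mul_card_subgroup N
      have h2 : 0 < Nat.card (G ⧸ N) := Nat.card_pos
      nlinarith
    obtain ⟨h, B, hB, hmono, hB0, hBtop, hfac⟩ := ih (G ⧸ N) hcard
    let f := QuotientGroup.mk' N
    have hf : Function.Surjective f := QuotientGroup.mk'_surjective N
    have hker : f.ker = N := QuotientGroup.ker_mk' N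
    have hcomap0 : (B 0).comap f = N := by rw [hB0, MonoidHom.comap_bot, hker]
    by_cases hc : IsMulCommutative T
    · let A : ℕ → Subgroup G := fun i => Nat.casesOn i ⊥ fun i => (B (i + 1)).comap f
      have hA : ∀ i, (A i).Normal := by
        rintro (_ | i)
        · exact (inferInstance : (⊥ : Subgroup G).Normal)
        · exact (hB (i + 1)).comap f
      refine ⟨h, A, hA, monotone_nat_of_le_succ ?_, rfl, ?_, ?_⟩
      · rintro (_ | i)
        · exact bot_le
        · exact Subgroup.comap_mono (hmono (Nat.le_succ _))
      · change (B (2 * h + 1)).comap f = ⊤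
        rw [hBtop, Subgroup.comap_top]
      · rintro (_ | i) hi
        · refine ⟨fun _ => ?_, fun hodd => absurd hodd (by decide)⟩
          obtain ⟨e1⟩ := nonempty_factor_mulEquiv_of_eq_bot (⊥ : Subgroup G) ((B 1).comap f) rfl
          obtain ⟨e2⟩ := nonempty_factor_mulEquiv_of_eq_bot (B 0) (B 1) hB0
          have hB1 : IsPSoluble p (B 1) := ((hfac 0 (Nat.zero_le _)).1 (by decide)).congr e2
          suffices hext : IsPSoluble p ((B 1).comap f) by
            change IsPSoluble p ((B 1).comap f ⧸ (⊥ : Subgroup G).subgroupOf ((B 1).comap f))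
            exact hext.congr e1.symm
          refine IsPSoluble.of_extension (f.subgroupComap (B 1))
            (f.subgroupComap_surjective_of_surjective (B 1) hf) ?_ hB1
          have hk : (f.subgroupComap (B 1)).ker = N.subgroupOf ((B 1).comap f) := by
            ext x
            rw [MonoidHom.mem_ker, Subgroup.mem_subgroupOf, Subtype.ext_iff]
            exact QuotientGroup.eq_one_iff (x : G)
          have hle : N ≤ (B 1).comap f := by
            exact hcomap0.symm.le.trans (Subgroup.comap_mono (hmono (Nat.zero_le 1)))
          have hcN : Nat.card N = Nat.card T ^ n := by
            rw [Nat.card_congr e.toEquiv, Nat.card_fun, Nat.card_fin]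
          rw [hk, Nat.card_congr (Subgroup.subgroupOfEquivOfLe hle).toEquiv, hcN]
          have hq : (Nat.card T).Prime := Group.is_simple_iff_prime_card.mp hs
          by_cases hpq : p = Nat.card T
          · exact Or.inl ⟨n, by rw [hpq]⟩
          · exact Or.inr fun hd => hpq ((Nat.prime_dvd_prime_iff_eq hp hq).mp
              (hp.dvd_of_dvd_pow hd))
        · obtain ⟨e1⟩ := nonempty_comap_factor_mulEquiv f hf (B (i + 1)) (B (i + 2))
          exact ⟨fun hev => ((hfac (i + 1) hi).1 hev).congr e1.symm,
            fun hodd => ((hfac (i + 1) hi).2 hodd).congr e1.symm⟩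
    · let A : ℕ → Subgroup G := fun i =>
        Nat.casesOn i ⊥ fun i => Nat.casesOn i ⊥ fun i => (B i).comap f
      have hA : ∀ i, (A i).Normal := by
        rintro (_ | _ | i)
        · exact (inferInstance : (⊥ : Subgroup G).Normal)
        · exact (inferInstance : (⊥ : Subgroup G).Normal)
        · exact (hB i).comap f
      refine ⟨h + 1, A, hA, monotone_nat_of_le_succ ?_, rfl, ?_, ?_⟩
      · rintro (_ | _ | i)
        · exact bot_le
        · exact bot_le
        · exact Subgroup.comap_mono (hmono (Nat.le_succ _))
      · change (B (2 * h + 1)).comap f = ⊤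
        rw [hBtop, Subgroup.comap_top]
      · rintro (_ | _ | i) hi
        · refine ⟨fun _ => ?_, fun hodd => absurd hodd (by decide)⟩
          obtain ⟨e1⟩ := nonempty_factor_mulEquiv_of_eq_bot (⊥ : Subgroup G) (⊥ : Subgroup G) rfl
          change IsPSoluble p ((⊥ : Subgroup G) ⧸ (⊥ : Subgroup G).subgroupOf ⊥)
          exact (IsPSoluble.of_subsingleton p (⊥ : Subgroup G)).congr e1.symm
        · refine ⟨fun hev => absurd hev (by decide), fun _ => ?_⟩
          obtain ⟨e1⟩ := nonempty_factor_mulEquiv_of_eq_bot (⊥ : Subgroup G) ((B 0).comap f) rfl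
          exact ⟨n, fun _ => T, fun _ => inferInstance, hn, fun _ => ⟨hs, hc⟩,
            ⟨e1.trans ((MulEquiv.subgroupCongr hcomap0).trans e)⟩⟩
        · obtain ⟨e1⟩ := nonempty_comap_factor_mulEquiv f hf (B i) (B (i + 1))
          have h2 : Even (i + 2) ↔ Even i := by simp [Nat.even_add]
          have h3 : Odd (i + 2) ↔ Odd i := by
            rw [← Nat.not_even_iff_odd, ← Nat.not_even_iff_odd, h2]
          exact ⟨fun hev => ((hfac i (by omega)).1 (h2.mp hev)).congr e1.symm,
            fun hodd => ((hfac i (by omega)).2 (h3.mp hodd)).congr e1.symm⟩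

theorem hasNonPSolubleSeries_nonPSolubleLength {p : ℕ} (hp : p.Prime) (G : Type u) [Group G]
    [Finite G] : HasNonPSolubleSeries p G (nonPSolubleLength p G) :=
  Nat.sInf_mem (exists_hasNonPSolubleSeries_of_card_le hp _ G le_rfl)

end GroupLength

namespace GroupLength

universe u

open scoped commutatorElement

/-! Both lengths are read off from ascending normal series in which the next factor is a functorial
subgroup of the quotient. For `h*` that subgroup is always `F*`; for `λ_p` it alternates between the
`p`-soluble radical and the join of the subnormal nonabelian simple subgroups. Write `G_i` and `M_i`
for the terms. In both cases the recipe has period two, and the theorem becomes one statement: `M_n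
= M` implies `G_(n+2) = G`. Two more terms cost 2 in `h*`, but only 1 in `λ_p`, where length `h`
corresponds to the index `2h + 1`.

Let `m` be largest with `G_m ≤ M`. Below `m` the series agree: `M_k = G_k` whenever `G_(k+1) ≤ M`.
In particular `M_(m-1) = G_(m-1) ≤ G_(m+1)` if `m > 0`. Since `M` is maximal and `G_(m+1)` is not
contained in it, `M` maps onto `G/G_j` for every `j > m`. Functors respect surjections, so the
inclusion propagates to `M_i ≤ G_(i+2)` for `i ≥ m - 1`. If `M_n = M`, then `G_(n+2)` contains `M`
without lying in it, hence equals `G`.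

The agreement below `m` rests on self-centralizing layers: `F*(X)` contains its centralizer, and if
the `p`-soluble radical of `X` is trivial, the simple layer of `X` has trivial centralizer. Hence a
nilpotent or `p`-soluble normal subgroup of `M/G_k` is forced into `G_(k+2)/G_k`, which is normal in
`G/G_k`, and so into the corresponding radical of `G/G_k`. A component commutes with any subgroup it
normalizes but does not lie in, so a component of `M/G_k` outside the layer would lie in that
layer's centralizer. -/

/-- A choice of a normal subgroup in every group that is compatible with surjections. -/
structure NormalFunctor : Type (u + 1) where
  /-- The chosen subgroup. -/
  obj : ∀ (G : Type u) [Group G], Subgroup G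
  normal : ∀ (G : Type u) [Group G], (obj G).Normal
  map_le : ∀ {G H : Type u} [Group G] [Group H] (f : G →* H), Function.Surjective f →
    (obj G).map f ≤ obj H

instance (ρ : NormalFunctor.{u}) (G : Type u) [Group G] : (ρ.obj G).Normal := ρ.normal G

/-- The terms of the series with factors prescribed by `ρ`, bundled with their normality. -/
def seriesAux (ρ : ℕ → NormalFunctor.{u}) (G : Type u) [Group G] : ℕ → {N : Subgroup G // N.Normal}
  | 0 => ⟨⊥, inferInstance⟩
  | i + 1 =>
    let F := seriesAux ρ G i
    haveI := F.2
    ⟨((ρ i).obj (G ⧸ F.1)).comap (QuotientGroup.mk' F.1), inferInstance⟩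

/-- The series of `G` that starts with the trivial subgroup and whose `i`-th factor is the
`ρ i`-subgroup of the quotient by the `i`-th term. -/
def series (ρ : ℕ → NormalFunctor.{u}) (G : Type u) [Group G] (i : ℕ) : Subgroup G :=
  (seriesAux ρ G i).1

/-! ### Comparing the series of a group and of a maximal subgroup -/

section series

variable (ρ : ℕ → NormalFunctor.{u}) (G : Type u) [Group G]

instance series_normal (i : ℕ) : (series ρ G i).Normal := (seriesAux ρ G i).2

theorem series_zero : series ρ G 0 = ⊥ := rfl

theorem series_succ (i : ℕ) : series ρ G (i + 1) =
    ((ρ i).obj (G ⧸ series ρ G i)).comap (QuotientGroup.mk' (series ρ G i)) := rfl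

theorem series_monotone : Monotone (series ρ G) := by
  refine monotone_nat_of_le_succ fun i x hx => ?_
  rw [series_succ, Subgroup.mem_comap, QuotientGroup.mk'_apply, (QuotientGroup.eq_one_iff x).mpr hx]
  exact one_mem _

variable {G} {ρ}

/-- The inclusion induces a surjection of the two quotients, to which functoriality applies. Only
the composite with the quotient map has to be onto, so `f` may be the inclusion of a maximal
subgroup. -/
theorem series_succ_le_comap {H : Type u} [Group H] {f : H →* G} {a b : ℕ}
    (hf : Function.Surjective ((QuotientGroup.mk' (series ρ G b)).comp f)) (hab : ρ a = ρ b)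
    (h : series ρ H a ≤ (series ρ G b).comap f) :
    series ρ H (a + 1) ≤ (series ρ G (b + 1)).comap f := by
  intro x hx
  have hs : Function.Surjective (QuotientGroup.map _ _ f h) := by
    intro y
    obtain ⟨z, rfl⟩ := hf y
    exact ⟨QuotientGroup.mk z, rfl⟩
  have h1 := (ρ a).map_le _ hs ⟨_, hx, rfl⟩
  rw [hab] at h1
  exact h1

theorem series_comp_eq_of_comap_eq {H : Type u} [Group H] {f : H →* G} {k : ℕ}
    (h : series ρ H k = (series ρ G k).comap f)
    (hstep : ∀ ι : H ⧸ series ρ H k →* G ⧸ series ρ G k, Function.Injective ι →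
      (∀ x : H, ι x = (f x : G)) →
      (ρ k).obj (H ⧸ series ρ H k) = ((ρ k).obj (G ⧸ series ρ G k)).comap ι) :
    series ρ H (k + 1) = (series ρ G (k + 1)).comap f := by
  let ι := QuotientGroup.map (series ρ H k) (series ρ G k) f h.le
  have hι : Function.Injective ι := by
    rw [injective_iff_map_eq_one]
    intro x
    induction x using QuotientGroup.induction_on with
    | H x =>
      intro hx
      have hx' : ((f x : G) : G ⧸ series ρ G k) = 1 := hx
      rw [QuotientGroup.eq_one_iff] at hx' ⊢
      rw [h]
      exact hx'
  rw [series_succ, hstep ι hι fun _ => rfl, series_succ]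
  rfl

/-- Modulo the `(k + 1)`-st term the hypothesis says that `x` centralizes the next factor, so a
self-centralizing factor absorbs it. This supplies the centralizer condition in `series_eq_comap`.
-/
theorem mem_map_series_of_commutator_mem {k : ℕ}
    (hself : Subgroup.centralizer ((ρ (k + 1)).obj (G ⧸ series ρ G (k + 1))) ≤
      (ρ (k + 1)).obj (G ⧸ series ρ G (k + 1))) (x : G ⧸ series ρ G k)
    (hx : ∀ a ∈ (series ρ G (k + 2)).map (QuotientGroup.mk' (series ρ G k)),
      ⁅x, a⁆ ∈ (ρ k).obj (G ⧸ series ρ G k)) :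
    x ∈ (series ρ G (k + 2)).map (QuotientGroup.mk' (series ρ G k)) := by
  obtain ⟨g, rfl⟩ := QuotientGroup.mk'_surjective _ x
  suffices hg : (g : G ⧸ series ρ G (k + 1)) ∈
      Subgroup.centralizer ((ρ (k + 1)).obj (G ⧸ series ρ G (k + 1))) from ⟨g, hself hg, rfl⟩
  rw [Subgroup.mem_centralizer_iff_commutator_eq_one]
  intro y hy
  obtain ⟨a, rfl⟩ := QuotientGroup.mk'_surjective _ y
  rw [← QuotientGroup.mk'_apply _ g, ← map_commutatorElement,
    QuotientGroup.mk'_apply, QuotientGroup.eq_one_iff, ← commutatorElement_inv, inv_mem_iff]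
  have h := hx _ ⟨a, hy, rfl⟩
  rw [← map_commutatorElement] at h
  exact h

/-- Reduces agreement of the series to one step `hstep` in the quotient by the `k`-th term, where
`Y` is the corresponding quotient of `M` and `A` is the image of the `(k + 2)`-nd term. The subgroup
`A` lies in the image of `M` because the comparison of terms `k + 1` assumes that term `k + 2` lies
in `M`. -/
theorem series_eq_comap {M : Subgroup G}
    (hstep : ∀ (k : ℕ) (Y : Type u) [Group Y] (ι : Y →* G ⧸ series ρ G k),
      Function.Injective ι → ∀ A : Subgroup (G ⧸ series ρ G k), A.Normal → A ≤ ι.range →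
      (ρ k).obj (G ⧸ series ρ G k) ≤ A →
      (Subgroup.centralizer ((ρ (k + 1)).obj (G ⧸ series ρ G (k + 1))) ≤
        (ρ (k + 1)).obj (G ⧸ series ρ G (k + 1)) →
        ∀ x, (∀ a ∈ A, ⁅x, a⁆ ∈ (ρ k).obj (G ⧸ series ρ G k)) → x ∈ A) →
      (ρ k).obj Y = ((ρ k).obj (G ⧸ series ρ G k)).comap ι)
    (k : ℕ) (hk : series ρ G (k + 1) ≤ M) : series ρ M k = (series ρ G k).comap M.subtype := by
  induction k with
  | zero =>
    rw [series_zero, series_zero, MonoidHom.comap_bot, Subgroup.ker_subtype]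
  | succ k ih =>
    refine series_comp_eq_of_comap_eq (ih ((series_monotone ρ G (Nat.le_succ _)).trans hk))
      fun ι hι hιx => hstep k _ ι hι ((series ρ G (k + 2)).map (QuotientGroup.mk' (series ρ G k)))
        ((series_normal ρ G _).map _ (QuotientGroup.mk'_surjective _)) ?_ ?_ fun hself =>
          mem_map_series_of_commutator_mem hself
    · rintro _ ⟨x, hx, rfl⟩
      exact ⟨((⟨x, hk hx⟩ : M) : M ⧸ series ρ M k), hιx _⟩
    · rw [← Subgroup.map_comap_eq_self_of_surjective (QuotientGroup.mk'_surjective (series ρ G k))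
        ((ρ k).obj (G ⧸ series ρ G k)), ← series_succ]
      exact Subgroup.map_mono (series_monotone ρ G (Nat.le_succ _))

theorem series_add_two_eq_top (hρ : ∀ i, ρ (i + 2) = ρ i) {M : Subgroup G} (hM : IsCoatom M)
    (hG : ∃ m, series ρ G m = ⊤)
    (hcomp : ∀ k, series ρ G (k + 1) ≤ M → series ρ M k = (series ρ G k).comap M.subtype)
    {n : ℕ} (hn : series ρ M n = ⊤) : series ρ G (n + 2) = ⊤ := by
  classical
  have hex : ∃ m, ¬ series ρ G m ≤ M := by
    obtain ⟨m, hm⟩ := hG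
    exact ⟨m, fun h => hM.1 (top_le_iff.mp (hm ▸ h))⟩
  obtain ⟨m, hm, hm'⟩ : ∃ m, series ρ G m ≤ M ∧ ¬ series ρ G (m + 1) ≤ M := by
    by_contra! h
    obtain ⟨m, hm⟩ := hex
    refine hm (Nat.rec bot_le (fun i hi => h i hi) m)
  -- Subtraction is truncated: for `m = 0` the induction starts at index 0 with the trivial
  -- subgroup.
  have hbase : series ρ M (m - 1) ≤ (series ρ G (m - 1 + 2)).comap M.subtype := by
    rcases m with _ | m
    · exact bot_le
    · rw [Nat.add_sub_cancel, hcomp m hm]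
      exact Subgroup.comap_mono (series_monotone ρ G (by omega))
  have hnle : ∀ i, ¬ series ρ G (m - 1 + i + 2) ≤ M := fun i h =>
    hm' ((series_monotone ρ G (by omega)).trans h)
  have hle : ∀ i, series ρ M (m - 1 + i) ≤ (series ρ G (m - 1 + i + 2)).comap M.subtype := by
    intro i
    induction i with
    | zero => exact hbase
    | succ i ih =>
      refine series_succ_le_comap ?_ (hρ _).symm ih
      have hsup : M ⊔ series ρ G (m - 1 + i + 2) = ⊤ :=
        hM.2 _ (left_lt_sup.mpr (hnle i))
      intro y
      obtain ⟨y, rfl⟩ := QuotientGroup.mk'_surjective _ y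
      obtain ⟨x, hx, z, hz, rfl⟩ := Subgroup.mem_sup_of_normal_right.mp
        (hsup ▸ Subgroup.mem_top y : y ∈ M ⊔ series ρ G (m - 1 + i + 2))
      refine ⟨⟨x, hx⟩, ?_⟩
      exact QuotientGroup.eq.mpr (by rw [Subgroup.coe_subtype, inv_mul_cancel_left]; exact hz)
  by_cases hnm : m - 1 ≤ n
  · obtain ⟨i, rfl⟩ := Nat.exists_eq_add_of_le hnm
    have h1 := hle i
    rw [hn] at h1
    refine hM.2 _ (lt_of_le_not_ge (fun x hx => ?_) (hnle i))
    exact h1 (Subgroup.mem_top (⟨x, hx⟩ : M))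
  -- If `n < m - 1`, then the `n`-th term of `G` contains `M`, while term `n + 2` still lies in `M`.
  -- Periodicity then keeps every term `n + 2 * i` inside `M`, contradicting the choice of `m`.
  · exfalso
    have h1 : M ≤ series ρ G n := by
      have h2 := hcomp n ((series_monotone ρ G (by omega)).trans hm)
      rw [hn] at h2
      intro x hx
      exact (h2 ▸ Subgroup.mem_top (⟨x, hx⟩ : M) :
        (⟨x, hx⟩ : M) ∈ (series ρ G n).comap M.subtype)
    have h2 : ∀ i, series ρ G (n + i + 2) ≤ (series ρ G (n + i)).comap (MonoidHom.id G) := by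
      intro i
      induction i with
      | zero => exact ((series_monotone ρ G (by omega)).trans hm).trans h1
      | succ i ih => exact series_succ_le_comap (QuotientGroup.mk'_surjective _) (hρ _) ih
    have h3 : ∀ i, series ρ G (n + 2 * i) ≤ M := by
      intro i
      induction i with
      | zero => exact (series_monotone ρ G (by omega)).trans hm
      | succ i ih => exact (h2 (2 * i)).trans ih
    exact hm' ((series_monotone ρ G (by omega)).trans (h3 (m + 1)))

end series

/-! ### Radicals of Fitting classes -/

section radical

/-- A class of groups closed under isomorphisms and containing the trivial groups whose finite
members are closed under normal subgroups and under products of normal subgroups. -/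
structure IsFittingClass (𝔛 : ∀ (G : Type u) [Group G], Prop) : Prop where
  of_subsingleton : ∀ (G : Type u) [Group G] [Subsingleton G], 𝔛 G
  congr : ∀ {G H : Type u} [Group G] [Group H], (G ≃* H) → 𝔛 G → 𝔛 H
  of_normal : ∀ {G : Type u} [Group G] [Finite G] (N : Subgroup G), N.Normal → 𝔛 G → 𝔛 N
  sup : ∀ {G : Type u} [Group G] [Finite G] (A B : Subgroup G), A.Normal → B.Normal →
    𝔛 A → 𝔛 B → 𝔛 (A ⊔ B : Subgroup G)

/-- The subgroup generated by all normal subgroups that belong to the class `𝔛`. -/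
def radical (𝔛 : ∀ (G : Type u) [Group G], Prop) (G : Type u) [Group G] : Subgroup G :=
  sSup {N : Subgroup G | N.Normal ∧ 𝔛 N}

variable {𝔛 : ∀ (G : Type u) [Group G], Prop} {G : Type u} [Group G]

theorem le_radical {N : Subgroup G} (hN : N.Normal) (h : 𝔛 N) : N ≤ radical 𝔛 G :=
  le_sSup ⟨hN, h⟩

theorem radical_normal (𝔛 : ∀ (G : Type u) [Group G], Prop) (G : Type u) [Group G] :
    (radical 𝔛 G).Normal := by
  rw [radical, sSup_eq_iSup']
  have : ∀ N : {N : Subgroup G | N.Normal ∧ 𝔛 N}, (N : Subgroup G).Normal := fun N => N.2.1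
  infer_instance

theorem map_radical_le (hq : ∀ (G H : Type u) [Group G] [Group H] (f : G →* H),
    Function.Surjective f → 𝔛 G → 𝔛 H) {H : Type u} [Group H] (f : G →* H)
    (hf : Function.Surjective f) : (radical 𝔛 G).map f ≤ radical 𝔛 H := by
  rw [Subgroup.map_le_iff_le_comap]
  refine sSup_le fun N hN => ?_
  rw [← Subgroup.map_le_iff_le_comap]
  exact le_radical (hN.1.map f hf) (hq _ _ _ (f.subgroupMap_surjective N) hN.2)

namespace IsFittingClass

variable (h𝔛 : IsFittingClass 𝔛)
include h𝔛

theorem radical_mem [Finite G] : 𝔛 (radical 𝔛 G) := by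
  obtain ⟨P, ⟨hP1, hP2⟩, hmax⟩ := Set.exists_max_image {P : Subgroup G | P.Normal ∧ 𝔛 P}
    (fun K => Nat.card K) (Set.toFinite _) ⟨⊥, inferInstance, h𝔛.of_subsingleton _⟩
  have : radical 𝔛 G = P := by
    refine le_antisymm (sSup_le fun N hN => ?_) (le_radical hP1 hP2)
    have := hN.1
    have h := hmax (P ⊔ N) ⟨inferInstance, h𝔛.sup P N hP1 hN.1 hP2 hN.2⟩
    rw [Subgroup.eq_of_le_of_card_ge le_sup_left h]
    exact le_sup_right
  rw [this]
  exact hP2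

theorem radical_characteristic : (radical 𝔛 G).Characteristic := by
  rw [Subgroup.characteristic_iff_map_le]
  intro φ
  rw [Subgroup.map_le_iff_le_comap]
  refine sSup_le fun N hN => ?_
  rw [← Subgroup.map_le_iff_le_comap]
  exact le_radical (hN.1.map _ φ.surjective)
    (h𝔛.congr (N.equivMapOfInjective φ.toMonoidHom φ.injective) hN.2)

theorem map_radical_subtype_le [Finite G] (A : Subgroup G) [A.Normal] :
    (radical 𝔛 A).map A.subtype ≤ radical 𝔛 G := by
  have := h𝔛.radical_characteristic (G := A)
  exact le_radical inferInstance
    (h𝔛.congr (Subgroup.equivMapOfInjective _ A.subtype A.subtype_injective) h𝔛.radical_mem)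

/-- The intersection is normal in `N`, hence in the class, and normal in `A`. So it lies in the
radical of `A`, which is characteristic in a normal subgroup of `G`. -/
theorem inf_le_radical [Finite G] {A N : Subgroup G} [A.Normal] (hAN : A ≤ Subgroup.normalizer N)
    (hN : 𝔛 N) : N ⊓ A ≤ radical 𝔛 G := by
  have h1 : (N.subgroupOf A).Normal := by
    rw [← Subgroup.inf_subgroupOf_right]
    refine (Subgroup.normal_subgroupOf_iff_le_normalizer inf_le_right).mpr fun a ha => ?_
    rw [Subgroup.mem_normalizer_iff]
    intro x
    rw [Subgroup.mem_inf, Subgroup.mem_inf, ← Subgroup.mem_normalizer_iff.mp (hAN ha) x]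
    refine and_congr_right fun _ => ⟨fun hx => mul_mem (mul_mem ha hx) (inv_mem ha), fun hx => ?_⟩
    have := mul_mem (mul_mem (inv_mem ha) hx) ha
    simpa [mul_assoc] using this
  have h2 : 𝔛 (N.subgroupOf A) := by
    have h3 : 𝔛 (A.subgroupOf N) := h𝔛.of_normal _ inferInstance hN
    refine h𝔛.congr ?_ h3
    exact ((A.subgroupOf N).equivMapOfInjective N.subtype N.subtype_injective).trans
      ((MulEquiv.subgroupCongr (by rw [Subgroup.subgroupOf_map_subtype,
        Subgroup.subgroupOf_map_subtype, inf_comm])).trans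
      ((N.subgroupOf A).equivMapOfInjective A.subtype A.subtype_injective).symm)
  have h3 := (Subgroup.map_mono (f := A.subtype) (le_radical h1 h2)).trans
    (h𝔛.map_radical_subtype_le A)
  rwa [Subgroup.subgroupOf_map_subtype] at h3

/-- For a normal subgroup `N` of `Y` in the class, `[N, A] ≤ N ∩ A ≤ radical 𝔛 G ≤ B`. The
centralizer condition then gives `N ≤ A`, so that `N = N ∩ A` is itself in the radical. -/
theorem map_radical_le_of_self_centralizing [Finite G] {Y : Type u} [Group Y] (ι : Y →* G)
    (hι : Function.Injective ι) {A B : Subgroup G} [A.Normal] (hA : A ≤ ι.range)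
    (hB : radical 𝔛 G ≤ B) (hAB : ∀ x, (∀ a ∈ A, ⁅x, a⁆ ∈ B) → x ∈ A) :
    (radical 𝔛 Y).map ι ≤ radical 𝔛 G := by
  rw [Subgroup.map_le_iff_le_comap]
  refine sSup_le fun N hN => ?_
  rw [← Subgroup.map_le_iff_le_comap]
  have hnorm : A ≤ Subgroup.normalizer (N.map ι) := by
    have := hN.1
    refine hA.trans ?_
    rintro _ ⟨y, rfl⟩
    rw [Subgroup.mem_normalizer_iff]
    intro x
    constructor
    · rintro ⟨n, hn, rfl⟩
      exact ⟨y * n * y⁻¹, this.conj_mem n hn y, by simp⟩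
    · rintro ⟨n, hn, h⟩
      refine ⟨y⁻¹ * n * y, by simpa using this.conj_mem n hn y⁻¹, ?_⟩
      rw [map_mul, map_mul, h, map_inv]
      group
  have hle := h𝔛.inf_le_radical hnorm (h𝔛.congr (N.equivMapOfInjective ι hι) hN.2)
  intro x hx
  refine hle ⟨hx, hAB x fun a ha => hB (hle ⟨?_, ?_⟩)⟩
  · rw [commutatorElement_def, mul_assoc, mul_assoc, ← mul_assoc a]
    exact (N.map ι).mul_mem hx
      ((Subgroup.mem_normalizer_iff.mp (hnorm ha) _).mp ((N.map ι).inv_mem hx))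
  · rw [commutatorElement_def]
    exact A.mul_mem (‹A.Normal›.conj_mem a ha x) (A.inv_mem ha)

end IsFittingClass

end radical

/-! ### Fitting's theorem for finite groups -/

section nilpotent

variable {G : Type u} [Group G]

theorem relIndex_sup_sup_dvd (A B N : Subgroup G) [A.Normal] [N.Normal] (hAB : A ≤ B) :
    (A ⊔ N).relIndex (B ⊔ N) ∣ A.relIndex B := by
  have h : B ⊔ N ⊔ (A ⊔ N) = B ⊔ (A ⊔ N) := by
    rw [sup_assoc, sup_left_comm N A N, sup_idem]
  have h' : B ⊔ N = B ⊔ (A ⊔ N) := by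
    rw [← sup_assoc, sup_eq_left.mpr hAB]
  rw [h', Subgroup.relIndex_sup_right]
  exact Subgroup.relIndex_dvd_of_le_left _ le_sup_left

theorem exists_normal_isPGroup_not_dvd_relIndex [Finite G] (H : Subgroup G) [H.Normal]
    [Group.IsNilpotent H] (p : ℕ) [Fact p.Prime] :
    ∃ P : Subgroup G, P.Normal ∧ IsPGroup p P ∧ P ≤ H ∧ ¬ p ∣ P.relIndex H := by
  obtain ⟨P⟩ := (inferInstance : Nonempty (Sylow p H))
  have h1 : (P : Subgroup H).Normal := inferInstance
  have h2 := P.characteristic_of_normal h1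
  refine ⟨(P : Subgroup H).map H.subtype, inferInstance, P.2.map _, Subgroup.map_subtype_le _, ?_⟩
  have h3 : ((P : Subgroup H).map H.subtype).relIndex H = (P : Subgroup H).index := by
    rw [Subgroup.relIndex, Subgroup.subgroupOf, Subgroup.comap_map_eq_self_of_injective
      H.subtype_injective]
  rw [h3]
  exact P.not_dvd_index

/-- For each prime, the Sylow subgroups `A` of `H` and `B` of `K` are normal in `G`. Their join is a
`p`-group of index prime to `p` in `H ⊔ K`, hence a normal Sylow subgroup. -/
theorem isNilpotent_sup [Finite G] (H K : Subgroup G) [H.Normal] [K.Normal]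
    [Group.IsNilpotent H] [Group.IsNilpotent K] : Group.IsNilpotent (H ⊔ K : Subgroup G) := by
  refine (Group.isNilpotent_of_finite_tfae.out 0 3).mpr ?_
  intro p hp P
  obtain ⟨A, hA1, hA2, hA3, hA4⟩ := exists_normal_isPGroup_not_dvd_relIndex H p
  obtain ⟨B, hB1, hB2, hB3, hB4⟩ := exists_normal_isPGroup_not_dvd_relIndex K p
  have h1 : IsPGroup p (A ⊔ B : Subgroup G) := hA2.to_sup_of_normal_right hB2
  have h2 : ¬ p ∣ (A ⊔ B).relIndex (H ⊔ K) := by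
    have h3 : A ⊔ B ≤ H ⊔ B := sup_le_sup_right hA3 _
    have h4 : H ⊔ B ≤ H ⊔ K := sup_le_sup_left hB3 _
    rw [← Subgroup.relIndex_mul_relIndex _ _ _ h3 h4, hp.out.dvd_mul]
    rintro (h | h)
    · exact hA4 (h.trans (relIndex_sup_sup_dvd A H B hA3))
    · rw [sup_comm, sup_comm H] at h
      exact hB4 (h.trans (relIndex_sup_sup_dvd B K H hB3))
  have h5 : IsPGroup p ((A ⊔ B).subgroupOf (H ⊔ K)) :=
    h1.comap_of_injective _ (Subgroup.subtype_injective _)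
  let Q := h5.toSylow h2
  have h6 : (Q : Subgroup (H ⊔ K : Subgroup G)).Normal :=
    (inferInstance : ((A ⊔ B).subgroupOf (H ⊔ K)).Normal)
  have := Sylow.unique_of_normal Q h6
  rw [Subsingleton.elim P Q]
  exact h6

theorem isFittingClass_isNilpotent :
    IsFittingClass fun (G : Type u) [Group G] => Group.IsNilpotent G where
  of_subsingleton _ _ _ := inferInstance
  congr e h := (Group.isNilpotent_congr e).mp h
  of_normal _ _ _ := inferInstance
  sup A B _ _ _ _ := isNilpotent_sup A B

end nilpotent

/-! ### Quasisimple groups and components -/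

section quasisimple

theorem nonempty_quotient_comap_mulEquiv {G H : Type u} [Group G] [Group H] (f : G →* H)
    (hf : Function.Surjective f) (Z : Subgroup H) [Z.Normal] :
    Nonempty (G ⧸ Z.comap f ≃* H ⧸ Z) := by
  have hker : Z.comap f = ((QuotientGroup.mk' Z).comp f).ker := by
    rw [← MonoidHom.comap_ker, QuotientGroup.ker_mk']
  exact ⟨(QuotientGroup.quotientMulEquivOfEq hker).trans
    (QuotientGroup.quotientKerEquivOfSurjective _ ((QuotientGroup.mk'_surjective Z).comp hf))⟩

variable {G : Type u} [Group G]

theorem IsQuasisimple.commutator_top (h : IsQuasisimple G) :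
    ⁅(⊤ : Subgroup G), (⊤ : Subgroup G)⁆ = ⊤ := by
  have := h.1
  exact Group.isPerfect_def.mp this

theorem IsQuasisimple.commutator_self {L : Subgroup G} (h : IsQuasisimple L) : ⁅L, L⁆ = L := by
  have := h.1
  exact Subgroup.commutator_eq_self

theorem IsQuasisimple.le_center_or_eq_top (h : IsQuasisimple G) (N : Subgroup G) [N.Normal] :
    N ≤ Subgroup.center G ∨ N = ⊤ := by
  have := h.2
  let π := QuotientGroup.mk' (Subgroup.center G)
  have hπ : Function.Surjective π := QuotientGroup.mk'_surjective _
  have hn : (N.map π).Normal := ‹N.Normal›.map π hπ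
  rcases hn.eq_bot_or_eq_top with hb | ht
  · left
    rw [Subgroup.map_eq_bot_iff, QuotientGroup.ker_mk'] at hb
    exact hb
  · right
    have hsup : N ⊔ Subgroup.center G = ⊤ := by
      have := congrArg (Subgroup.comap π) ht
      rwa [Subgroup.comap_map_eq, QuotientGroup.ker_mk', Subgroup.comap_top] at this
    -- If `N Z(G) = G`, then `G = [G, G] = [N Z(G), G] = [N, G] ≤ N`.
    rw [eq_top_iff, ← h.commutator_top, Subgroup.commutator_le]
    intro x _ y _
    obtain ⟨a, ha, z, hz, rfl⟩ := Subgroup.mem_sup_of_normal_right.mp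
      (hsup ▸ Subgroup.mem_top x : x ∈ N ⊔ Subgroup.center G)
    have h1 : ⁅a * z, y⁆ = ⁅a, y⁆ := by
      rw [Subgroup.mem_center_iff] at hz
      rw [commutatorElement_def, commutatorElement_def, mul_inv_rev, mul_assoc a z y, ← hz y]
      group
    rw [h1]
    exact Subgroup.commutator_le_left N ⊤ (Subgroup.commutator_mem_commutator ha trivial)

theorem IsQuasisimple.of_surjective {H : Type u} [Group H] [Nontrivial H] (h : IsQuasisimple G)
    (f : G →* H) (hf : Function.Surjective f) : IsQuasisimple H := by
  have := h.1
  have hH : Group.IsPerfect H := Group.IsPerfect.ofSurjective hf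
  have hc : (Subgroup.center H).comap f = Subgroup.center G := by
    refine le_antisymm ((h.le_center_or_eq_top _).resolve_right fun ht => ?_) fun x hx => ?_
    · have h1 : Subgroup.center H = ⊤ := by
        rw [← Subgroup.map_comap_eq_self_of_surjective hf (Subgroup.center H), ht,
          Subgroup.map_top_of_surjective f hf]
      refine Group.IsPerfect.not_isMulCommutative (G := H) ?_
      rw [isMulCommutative_iff]
      exact fun a b => Subgroup.mem_center_iff.mp (h1 ▸ Subgroup.mem_top b) a
    · rw [Subgroup.mem_comap, Subgroup.mem_center_iff]
      intro y
      obtain ⟨y, rfl⟩ := hf y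
      rw [← map_mul, Subgroup.mem_center_iff.mp hx y, map_mul]
  obtain ⟨e⟩ := nonempty_quotient_comap_mulEquiv f hf (Subgroup.center H)
  have := h.2
  exact ⟨hH, ((QuotientGroup.quotientMulEquivOfEq hc).symm.trans e).symm.isSimpleGroup⟩

/-- A perfect central extension of a quasisimple group is quasisimple. -/
theorem IsQuasisimple.of_isPerfect {H : Type u} [Group H] [hG : Group.IsPerfect G]
    (h : IsQuasisimple H) (f : G →* H) (hf : Function.Surjective f)
    (hker : f.ker ≤ Subgroup.center G) : IsQuasisimple G := by
  have hc : (Subgroup.center H).comap f = Subgroup.center G := by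
    refine le_antisymm ?_ fun x hx => ?_
    · set C := (Subgroup.center H).comap f
      have h1 : ⁅⁅(⊤ : Subgroup G), C⁆, (⊤ : Subgroup G)⁆ = ⊥ := by
        rw [Subgroup.commutator_top_right_eq_bot_iff_le_center]
        refine le_trans ?_ hker
        rw [Subgroup.commutator_le]
        intro x _ c hc
        rw [MonoidHom.mem_ker, map_commutatorElement, commutatorElement_eq_one_iff_mul_comm]
        exact Subgroup.mem_center_iff.mp hc _
      -- By the three subgroups lemma `[[G, G], C] = 1`, and perfectness makes `C` central.
      have h2 := Subgroup.commutator_commutator_eq_bot_of_rotate h1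
        (by rwa [Subgroup.commutator_comm C])
      rw [← commutator_def, Group.isPerfect_def.mp hG] at h2
      exact Subgroup.commutator_top_left_eq_bot_iff_le_center.mp h2
    · rw [Subgroup.mem_comap, Subgroup.mem_center_iff]
      intro y
      obtain ⟨y, rfl⟩ := hf y
      rw [← map_mul, Subgroup.mem_center_iff.mp hx y, map_mul]
  obtain ⟨e⟩ := nonempty_quotient_comap_mulEquiv f hf (Subgroup.center H)
  have := h.2
  exact ⟨hG, ((QuotientGroup.quotientMulEquivOfEq hc).symm.trans e).isSimpleGroup⟩

/-- Climbs the subnormal chain from `K` to the whole group. If `A` is normal in `B` and `[N ∩ A, L]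
= 1`, then `[N ∩ B, L] ≤ N ∩ A`, so `[[N ∩ B, L], L] = 1`. The three subgroups lemma and `[L, L] =
L` give `[N ∩ B, L] = 1`. -/
theorem commutator_eq_bot_of_isSubnormal {L K N : Subgroup G} (hK : K.IsSubnormal) (hLK : L ≤ K)
    (hN : L ≤ Subgroup.normalizer N) (hL : ⁅L, L⁆ = L) (h : ⁅N ⊓ K, L⁆ = ⊥) : ⁅N, L⁆ = ⊥ := by
  induction hK with
  | top => rwa [inf_top_eq] at h
  | step A B hAB _ hA ih =>
    refine ih (hLK.trans hAB) ?_
    have h1 : ⁅N ⊓ B, L⁆ ≤ N ⊓ A := by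
      refine le_inf ?_ ?_
      · exact (Subgroup.commutator_mono inf_le_left le_rfl).trans
          (Subgroup.le_normalizer_iff_commutator_le_left.mp hN)
      · refine (Subgroup.commutator_mono inf_le_right hLK).trans ?_
        exact Subgroup.le_normalizer_iff_commutator_le_right.mp
          ((Subgroup.normal_subgroupOf_iff_le_normalizer hAB).mp hA)
    have h2 : ⁅⁅N ⊓ B, L⁆, L⁆ = ⊥ := by
      rw [eq_bot_iff, ← h]
      exact Subgroup.commutator_mono h1 le_rfl
    have h3 := Subgroup.commutator_commutator_eq_bot_of_rotate
      (by rwa [Subgroup.commutator_comm L]) h2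
    rwa [hL, Subgroup.commutator_comm] at h3

/-- A component is contained in every subgroup that it normalizes or commutes with it. -/
theorem IsQuasisimple.le_or_commutator_eq_bot {L N : Subgroup G} (h : IsQuasisimple L)
    (hL : L.IsSubnormal) (hN : L ≤ Subgroup.normalizer N) : L ≤ N ∨ ⁅N, L⁆ = ⊥ := by
  have hn : (N.subgroupOf L).Normal := by
    refine ⟨fun x hx y => ?_⟩
    exact (Subgroup.mem_normalizer_iff.mp (hN y.2) x).mp hx
  rcases h.le_center_or_eq_top (N.subgroupOf L) with hc | ht
  · right
    refine commutator_eq_bot_of_isSubnormal hL le_rfl hN h.commutator_self ?_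
    rw [eq_bot_iff, Subgroup.commutator_le]
    rintro x ⟨hxN, hxL⟩ y hy
    rw [Subgroup.mem_bot, commutatorElement_eq_one_iff_mul_comm]
    have hx : (⟨x, hxL⟩ : L) ∈ Subgroup.center L := hc hxN
    exact (congrArg Subtype.val (Subgroup.mem_center_iff.mp hx ⟨y, hy⟩)).symm
  · exact Or.inl (Subgroup.subgroupOf_eq_top.mp ht)

theorem IsQuasisimple.of_isSimpleGroup [IsSimpleGroup G] (hc : ¬ IsMulCommutative G) :
    IsQuasisimple G := by
  have hcen : Subgroup.center G = ⊥ := by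
    refine (Subgroup.Normal.eq_bot_or_eq_top inferInstance).resolve_right fun h => hc ?_
    rw [isMulCommutative_iff]
    exact fun a b => Subgroup.mem_center_iff.mp (h ▸ Subgroup.mem_top b) a
  refine ⟨⟨(Subgroup.Normal.eq_bot_or_eq_top inferInstance).resolve_left fun h => hc ?_⟩, ?_⟩
  · exact (commutator_eq_bot_iff G).mp h
  · exact ((QuotientGroup.quotientMulEquivOfEq hcen).trans
      QuotientGroup.quotientBot).isSimpleGroup

end quasisimple

/-! ### The generalized Fitting subgroup and the bound for its height -/

section generalizedFitting

theorem map_generalizedFittingSubgroup_le {G H : Type u} [Group G] [Group H] (f : G →* H)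
    (hf : Function.Surjective f) :
    (generalizedFittingSubgroup G).map f ≤ generalizedFittingSubgroup H := by
  rw [generalizedFittingSubgroup, Subgroup.map_sup]
  refine sup_le_sup ?_ ?_
  · refine map_radical_le (𝔛 := fun (H : Type u) [Group H] => Group.IsNilpotent H) ?_ f hf
    intro G H _ _ f hf h
    exact Group.nilpotent_of_surjective (h := h) f hf
  · rw [Subgroup.map_le_iff_le_comap]
    refine sSup_le fun K hK => ?_
    rw [← Subgroup.map_le_iff_le_comap]
    rcases subsingleton_or_nontrivial (K.map f) with hs | hn
    · rw [Subgroup.eq_bot_of_subsingleton (K.map f)]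
      exact bot_le
    · exact le_sSup ⟨hK.1.map hf, hK.2.of_surjective _ (f.subgroupMap_surjective K)⟩

/-- The generalized Fitting subgroup as a functor. -/
def generalizedFittingFunctor : NormalFunctor.{u} where
  obj G := generalizedFittingSubgroup G
  normal _ := inferInstance
  map_le f hf := map_generalizedFittingSubgroup_le f hf

theorem series_generalizedFittingFunctor (G : Type u) [Group G] (i : ℕ) :
    series (fun _ => generalizedFittingFunctor) G i = generalizedFittingSeries G i := by
  have : seriesAux (fun _ => generalizedFittingFunctor) G i = generalizedFittingSeriesAux G i := by
    induction i with
    | zero => rfl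
    | succ i ih =>
      exact congrArg (fun F : {N : Subgroup G // N.Normal} =>
        haveI := F.2
        (⟨(generalizedFittingSubgroup (G ⧸ F.1)).comap (QuotientGroup.mk' F.1), inferInstance⟩ :
          {N : Subgroup G // N.Normal})) ih
  exact congrArg Subtype.val this

theorem map_subtype_le_layer {G : Type u} [Group G] {A : Subgroup G} (hA : A.IsSubnormal) :
    (layer A).map A.subtype ≤ layer G := by
  rw [Subgroup.map_le_iff_le_comap]
  refine sSup_le fun K hK => ?_
  rw [← Subgroup.map_le_iff_le_comap]
  exact le_sSup ⟨hK.1.trans' hA, hK.2.congr (K.equivMapOfInjective _ A.subtype_injective)⟩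

/-- The generalized Fitting subgroup contains its centralizer. -/
theorem centralizer_generalizedFittingSubgroup_le (G : Type u) [Group G] [Finite G] :
    Subgroup.centralizer (generalizedFittingSubgroup G) ≤ generalizedFittingSubgroup G := by
  set F := generalizedFittingSubgroup G with hF
  set C := Subgroup.centralizer (F : Set G) with hC
  have hCn : C.Normal := inferInstance
  -- `Z = C ∩ F` is central in `C`. If `C` is not inside `F`, then `C/Z` has nontrivial `F*`.
  -- Nilpotent normal subgroups and components of `C/Z` lift to nilpotent normal subgroups and
  -- components of `C`; these lie in `F`, so their images are trivial.
  let Z : Subgroup C := F.subgroupOf C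
  let π := QuotientGroup.mk' Z
  have hZ : Z ≤ Subgroup.center C := by
    intro z hz
    rw [Subgroup.mem_center_iff]
    intro c
    exact Subtype.ext (Subgroup.mem_centralizer_iff.mp c.2 _ hz).symm
  have hle : ∀ W : Subgroup C, W.map C.subtype ≤ F → W.map π = ⊥ := by
    intro W hW
    rw [Subgroup.map_eq_bot_iff, QuotientGroup.ker_mk']
    exact fun x hx => hW ⟨x, hx, rfl⟩
  have hker : ∀ T : Subgroup (C ⧸ Z),
      (π.subgroupComap T).ker ≤ Subgroup.center (T.comap π) := by
    intro T x hx
    have hx' : π x = 1 := congrArg Subtype.val (MonoidHom.mem_ker.mp hx)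
    have h1 : (x : C) ∈ Z := (QuotientGroup.eq_one_iff _).mp hx'
    rw [Subgroup.mem_center_iff]
    exact fun y => Subtype.ext (Subgroup.mem_center_iff.mp (hZ h1) y)
  have hsurj := fun T : Subgroup (C ⧸ Z) =>
    π.subgroupComap_surjective_of_surjective T (QuotientGroup.mk'_surjective _)
  by_contra hne
  have : Nontrivial (C ⧸ Z) := by
    rw [QuotientGroup.nontrivial_iff, Ne, Subgroup.subgroupOf_eq_top]
    exact hne
  refine generalizedFittingSubgroup_ne_bot (C ⧸ Z) ?_
  rw [eq_bot_iff, generalizedFittingSubgroup]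
  refine sup_le (sSup_le fun N hN => ?_) (sSup_le fun K hK => ?_)
  · have := hN.2
    have h1 : Group.IsNilpotent (N.comap π) :=
      Subgroup.isNilpotent_of_ker_le_center (π.subgroupComap N) (hker N)
    have h2 : (N.comap π).map C.subtype ≤ F :=
      ((Subgroup.map_mono (le_radical (hN.1.comap π) h1)).trans
        (isFittingClass_isNilpotent.map_radical_subtype_le C)).trans le_sup_left
    rw [← hle _ h2, Subgroup.map_comap_eq_self_of_surjective (QuotientGroup.mk'_surjective _)]
  · let T := K.comap π
    -- The preimage `T` of a component need not be perfect, but its derived subgroup still maps onto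
    -- `K`.
    let D : Subgroup T := ⁅(⊤ : Subgroup T), (⊤ : Subgroup T)⁆
    let f : D →* K := (π.subgroupComap K).comp D.subtype
    have hDmap : D.map (π.subgroupComap K) = ⊤ := by
      rw [Subgroup.map_commutator, Subgroup.map_top_of_surjective _ (hsurj K),
        hK.2.commutator_top]
    have hf : Function.Surjective f := by
      intro y
      obtain ⟨x, hx, rfl⟩ := (hDmap ▸ Subgroup.mem_top y : y ∈ D.map (π.subgroupComap K))
      exact ⟨⟨x, hx⟩, rfl⟩
    have hperf : Group.IsPerfect D := by
      rw [Subgroup.isPerfect_iff]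
      refine le_antisymm (Subgroup.commutator_mono le_top le_top) ?_
      -- Since `T = D Z(T)`, commutators of `T` are already commutators of `D`, so `D` is perfect.
      have hsup : ∀ x : T, ∃ d ∈ D, ∃ z ∈ Subgroup.center T, x = d * z := by
        intro x
        obtain ⟨d, hd, hdx⟩ := (hDmap ▸ Subgroup.mem_top (π.subgroupComap K x) :
          π.subgroupComap K x ∈ D.map (π.subgroupComap K))
        refine ⟨d, hd, d⁻¹ * x, hker K ?_, by group⟩
        rw [MonoidHom.mem_ker, map_mul, map_inv, hdx, inv_mul_cancel]
      change ⁅(⊤ : Subgroup T), (⊤ : Subgroup T)⁆ ≤ _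
      rw [Subgroup.commutator_le]
      intro x _ y _
      obtain ⟨d, hd, z, hz, rfl⟩ := hsup x
      obtain ⟨e, he, w, hw, rfl⟩ := hsup y
      have h1 : ⁅d * z, e * w⁆ = ⁅d, e⁆ := by
        rw [Subgroup.mem_center_iff] at hz hw
        have h2 : d * z * (e * w) = d * e * (z * w) := by
          rw [mul_assoc, ← mul_assoc z, ← hz e]; group
        have h3 : e * w * (d * z) = e * d * (z * w) := by
          rw [mul_assoc, ← mul_assoc w, ← hw d, mul_assoc d, ← hw z, ← mul_assoc]
        have h4 : ∀ a b : T, ⁅a, b⁆ = (a * b) * (b * a)⁻¹ := fun a b => by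
          rw [commutatorElement_def]; group
        rw [h4, h2, h3, h4]
        group
      rw [h1]
      exact Subgroup.commutator_mem_commutator hd he
    have hq : IsQuasisimple D := by
      refine hK.2.of_isPerfect f hf fun x hx => ?_
      have h1 : (x : T) ∈ Subgroup.center T := hker K hx
      rw [Subgroup.mem_center_iff] at h1 ⊢
      exact fun y => Subtype.ext (h1 y)
    have hDs : D.IsSubnormal := Subgroup.Normal.isSubnormal inferInstance
    have h1 : D ≤ layer T := le_sSup ⟨hDs, hq⟩
    have h2 : (D.map T.subtype).map C.subtype ≤ F :=
      ((Subgroup.map_mono ((Subgroup.map_mono h1).trans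
        (map_subtype_le_layer (hK.1.comap π)))).trans
        (map_subtype_le_layer hCn.isSubnormal)).trans le_sup_right
    have h3 := hle _ h2
    intro y hy
    obtain ⟨x, hx⟩ := hf ⟨y, hy⟩
    rw [← h3]
    exact ⟨x, ⟨x, x.2, rfl⟩, congrArg Subtype.val hx⟩

/-- A subgroup that contains the second term of the generalized Fitting series has the same
generalized Fitting subgroup as the whole group. -/
theorem generalizedFittingSubgroup_eq_comap {G Y : Type u} [Group G] [Group Y] [Finite G]
    (ι : Y →* G) (hι : Function.Injective ι) {A : Subgroup G} [A.Normal] (hA : A ≤ ι.range)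
    (hF : generalizedFittingSubgroup G ≤ A)
    (hAF : ∀ x, (∀ a ∈ A, ⁅x, a⁆ ∈ generalizedFittingSubgroup G) → x ∈ A) :
    generalizedFittingSubgroup Y = (generalizedFittingSubgroup G).comap ι := by
  have hmap : ∀ N : Subgroup G, N ≤ A → N = (N.comap ι).map ι := fun N hN =>
    (Subgroup.map_comap_eq_self (hN.trans hA)).symm
  refine le_antisymm ?_ ?_
  · refine sup_le ?_ (sSup_le fun L hL => ?_)
    · rw [← Subgroup.map_le_iff_le_comap]
      exact (isFittingClass_isNilpotent.map_radical_le_of_self_centralizing ι hι hA le_sup_left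
        hAF).trans le_sup_left
    · set N := (generalizedFittingSubgroup G).comap ι with hN
      have hnn : N.Normal := inferInstance
      -- A component of `Y` that is not in `F*(G)` would centralize it, and `F*(G)` contains its own
      -- centralizer.
      rcases hL.2.le_or_commutator_eq_bot (N := N) hL.1
        (by rw [Subgroup.normalizer_eq_top]; exact le_top) with h | h
      · exact h
      · rw [← Subgroup.map_le_iff_le_comap]
        refine le_trans ?_ (centralizer_generalizedFittingSubgroup_le G)
        rw [Subgroup.commutator_comm] at h
        rw [← Subgroup.commutator_eq_bot_iff_le_centralizer, hmap _ hF, ← Subgroup.map_commutator,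
          h, Subgroup.map_bot]
  · rw [← Subgroup.comap_map_eq_self_of_injective hι (generalizedFittingSubgroup Y)]
    refine Subgroup.comap_mono (sup_le (sSup_le fun N hN => ?_) (sSup_le fun K hK => ?_))
    · have h1 : N ≤ A := (le_sSup hN : N ≤ fittingSubgroup G).trans (le_sup_left.trans hF)
      rw [hmap N h1]
      refine Subgroup.map_mono (le_trans (le_radical (hN.1.comap ι) ?_) le_sup_left)
      have := hN.2
      exact Subgroup.isNilpotent_of_ker_le_center (ι.subgroupComap N) (by
        rw [(MonoidHom.ker_eq_bot_iff _).mpr]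
        · exact bot_le
        · exact fun x y hxy => Subtype.ext (hι (congrArg Subtype.val hxy)))
    · have h1 : K ≤ A := (le_sSup hK : K ≤ layer G).trans (le_sup_right.trans hF)
      rw [hmap K h1]
      refine Subgroup.map_mono (le_trans (?_ : _ ≤ layer Y) le_sup_right)
      refine le_sSup ⟨hK.1.comap ι, ?_⟩
      exact hK.2.congr ((MulEquiv.subgroupCongr (hmap K h1)).trans
        ((K.comap ι).equivMapOfInjective ι hι).symm)

theorem generalizedFittingSeries_add_two_eq_top {G : Type u} [Group G] [Finite G]
    {M : Subgroup G} (hM : IsCoatom M) {n : ℕ} (hn : generalizedFittingSeries M n = ⊤) :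
    generalizedFittingSeries G (n + 2) = ⊤ := by
  set ρ : ℕ → NormalFunctor.{u} := fun _ => generalizedFittingFunctor with hρ
  rw [← series_generalizedFittingFunctor] at hn ⊢
  refine series_add_two_eq_top (fun _ => rfl) hM ?_ ?_ hn
  · obtain ⟨m, hm⟩ := exists_generalizedFittingSeries_eq_top G
    exact ⟨m, by rwa [series_generalizedFittingFunctor]⟩
  · refine series_eq_comap (fun k Y _ ι hι A hAn hA hF hAF => ?_)
    exact generalizedFittingSubgroup_eq_comap ι hι hA hF
      (hAF (centralizer_generalizedFittingSubgroup_le _))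

end generalizedFitting

/-! ### `p`-soluble groups and their radical -/

section pSoluble

variable {p : ℕ}

/-- `n` is a power of `p` or not divisible by `p`. -/
def IsPowOrNotDvd (p n : ℕ) : Prop := (∃ k : ℕ, n = p ^ k) ∨ ¬ p ∣ n

theorem IsPowOrNotDvd.of_dvd (hp : p.Prime) {m n : ℕ} (hmn : m ∣ n) (h : IsPowOrNotDvd p n) :
    IsPowOrNotDvd p m := by
  rcases h with ⟨k, rfl⟩ | h
  · obtain ⟨j, _, hj⟩ := (Nat.dvd_prime_pow hp).mp hmn
    exact Or.inl ⟨j, hj⟩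
  · exact Or.inr fun hd => h (hd.trans hmn)

theorem IsPSoluble.of_surjective (hp : p.Prime) {G H : Type u} [Group G] [Group H] (f : G →* H)
    (hf : Function.Surjective f) (h : IsPSoluble p G) : IsPSoluble p H := by
  obtain ⟨n, N, h1, h2, h3, h4, h5⟩ := h
  refine ⟨n, fun i => (N i).map f, fun i => (h1 i).map f hf,
    fun i j hij => Subgroup.map_mono (h2 hij), by simp [h3],
    by simpa only [h4] using Subgroup.map_top_of_surjective f hf, fun i hi => ?_⟩
  have := h1 i
  refine IsPowOrNotDvd.of_dvd hp ?_ (h5 i hi)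
  rw [Subgroup.relIndex_map_map]
  exact relIndex_sup_sup_dvd _ _ _ (h2 i.le_succ)

theorem IsPSoluble.subgroup (hp : p.Prime) {G : Type u} [Group G] (H : Subgroup G)
    (h : IsPSoluble p G) : IsPSoluble p H := by
  obtain ⟨n, N, h1, h2, h3, h4, h5⟩ := h
  refine ⟨n, fun i => (N i).subgroupOf H, fun i => (h1 i).comap _,
    fun i j hij => Subgroup.comap_mono (h2 hij), by simp [h3], by simp [h4], fun i hi => ?_⟩
  have := h1 i
  refine IsPowOrNotDvd.of_dvd hp ?_ (h5 i hi)
  change ((N i).comap H.subtype).relIndex ((N (i + 1)).subgroupOf H) ∣ _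
  rw [Subgroup.relIndex_comap, Subgroup.subgroupOf_map_subtype,
    ← Subgroup.relIndex_subgroupOf (inf_le_left : N (i + 1) ⊓ H ≤ N (i + 1))]
  exact Subgroup.relIndex_dvd_index_of_normal _ _

theorem IsPSoluble.of_card {G : Type u} [Group G] (h : IsPowOrNotDvd p (Nat.card G)) :
    IsPSoluble p G := by
  refine IsPSoluble.of_extension (1 : G →* PUnit.{u + 1}) (fun _ => ⟨1, rfl⟩) ?_
    (IsPSoluble.of_subsingleton p _)
  rw [MonoidHom.ker_one, Subgroup.card_top]
  exact h

theorem card_sup_dvd {G : Type u} [Group G] (A B : Subgroup G) [B.Normal] :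
    Nat.card (A ⊔ B : Subgroup G) ∣ Nat.card B * Nat.card A := by
  rw [← Subgroup.relIndex_bot_left (A ⊔ B),
    ← Subgroup.relIndex_mul_relIndex ⊥ B (A ⊔ B) bot_le le_sup_right, Subgroup.relIndex_bot_left,
    Subgroup.relIndex_sup_right]
  exact mul_dvd_mul_left _ (Subgroup.relIndex_dvd_card _ _)

theorem isFittingClass_card_eq_pow (hp : p.Prime) :
    IsFittingClass fun (G : Type u) [Group G] => ∃ k : ℕ, Nat.card G = p ^ k where
  of_subsingleton G _ _ := ⟨0, by simp⟩
  congr e h := by rwa [← Nat.card_congr e.toEquiv]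
  of_normal N _ h := by
    obtain ⟨k, hk⟩ := h
    obtain ⟨j, _, hj⟩ := (Nat.dvd_prime_pow hp).mp (hk ▸ N.card_subgroup_dvd_card)
    exact ⟨j, hj⟩
  sup A B _ _ hA hB := by
    obtain ⟨k, hk⟩ := hA
    obtain ⟨l, hl⟩ := hB
    have h := card_sup_dvd A B
    rw [hk, hl, ← pow_add] at h
    obtain ⟨j, _, hj⟩ := (Nat.dvd_prime_pow hp).mp h
    exact ⟨j, hj⟩

theorem isFittingClass_not_dvd_card (hp : p.Prime) :
    IsFittingClass fun (G : Type u) [Group G] => ¬ p ∣ Nat.card G where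
  of_subsingleton G _ _ := by simpa using hp.ne_one
  congr e h := by rwa [← Nat.card_congr e.toEquiv]
  of_normal N _ h := fun hd => h (hd.trans N.card_subgroup_dvd_card)
  sup A B _ _ hA hB := fun hd =>
    (hp.dvd_mul.mp (hd.trans (card_sup_dvd A B))).elim hB hA

/-- The first nontrivial term of the series is a `p`-group or a `p'`-group, so the largest normal
subgroup of that kind is nontrivial. -/
theorem IsPSoluble.exists_characteristic (hp : p.Prime) {G : Type u} [Group G] [Finite G]
    [Nontrivial G] (h : IsPSoluble p G) :
    ∃ K : Subgroup G, K.Characteristic ∧ K ≠ ⊥ ∧ IsPowOrNotDvd p (Nat.card K) := by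
  obtain ⟨n, N, h1, h2, h3, h4, h5⟩ := h
  obtain ⟨i, hi, hbot, hne⟩ : ∃ i < n, N i = ⊥ ∧ N (i + 1) ≠ ⊥ := by
    by_contra! hc
    have hall : ∀ i ≤ n, N i = ⊥ := by
      intro i
      induction i with
      | zero => exact fun _ => h3
      | succ i ih => exact fun hi => hc i hi (ih (by omega))
    exact bot_ne_top ((hall n le_rfl).symm.trans h4)
  have h6 := h5 i hi
  rw [hbot, Subgroup.relIndex_bot_left] at h6
  rcases h6 with h6 | h6
  · refine ⟨_, (isFittingClass_card_eq_pow hp).radical_characteristic, fun hb => hne ?_,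
      Or.inl (isFittingClass_card_eq_pow hp).radical_mem⟩
    exact le_bot_iff.mp (hb ▸ le_radical (h1 _) h6)
  · refine ⟨_, (isFittingClass_not_dvd_card hp).radical_characteristic, fun hb => hne ?_,
      Or.inr (isFittingClass_not_dvd_card hp).radical_mem⟩
    exact le_bot_iff.mp (hb ▸ le_radical (h1 _) h6)

/-- Induction on the order: a characteristic `p`- or `p'`-subgroup of the kernel is normal in `G`,
and factoring it out leaves a smaller extension. -/
theorem IsPSoluble.of_ker_of_card_le (hp : p.Prime) (n : ℕ) :
    ∀ {G H : Type u} [Group G] [Group H] [Finite G], Nat.card G ≤ n → ∀ f : G →* H,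
      Function.Surjective f → IsPSoluble p f.ker → IsPSoluble p H → IsPSoluble p G := by
  induction n with
  | zero =>
    intro G _ _ _ _ hG
    exact absurd hG (not_le.mpr Nat.card_pos)
  | succ n ih =>
    intro G H _ _ _ hG f hf hker hH
    rcases subsingleton_or_nontrivial f.ker with hs | hn
    · have hinj := (MonoidHom.ker_eq_bot_iff f).mp (Subgroup.eq_bot_of_subsingleton _)
      exact hH.congr (MulEquiv.ofBijective f ⟨hinj, hf⟩).symm
    obtain ⟨K, hK1, hK2, hK3⟩ := hker.exists_characteristic hp
    set K' := K.map f.ker.subtype with hK'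
    have hK'n : K'.Normal := inferInstance
    have hcard : Nat.card K' = Nat.card K := Subgroup.card_map_of_injective f.ker.subtype_injective
    have hle : K' ≤ f.ker := Subgroup.map_subtype_le K
    have hq : Nat.card (G ⧸ K') ≤ n := by
      have h1 := Subgroup.card_eq_card_quotient_mul_card_subgroup K'
      have h2 : 0 < Nat.card (G ⧸ K') := Nat.card_pos
      have h3 : 1 < Nat.card K' := by
        rw [hcard]
        exact (Subgroup.one_lt_card_iff_ne_bot K).mpr hK2
      nlinarith
    refine IsPSoluble.of_extension (QuotientGroup.mk' K') (QuotientGroup.mk'_surjective _) ?_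
      (ih hq (QuotientGroup.lift K' f hle) (QuotientGroup.lift_surjective_of_surjective _ _ hf _)
        ?_ hH)
    · rw [QuotientGroup.ker_mk', hcard]
      exact hK3
    · rw [QuotientGroup.ker_lift]
      exact hker.of_surjective hp _ ((QuotientGroup.mk' K').subgroupMap_surjective f.ker)

theorem IsPSoluble.of_ker (hp : p.Prime) {G H : Type u} [Group G] [Group H] [Finite G]
    (f : G →* H) (hf : Function.Surjective f) (hker : IsPSoluble p f.ker) (hH : IsPSoluble p H) :
    IsPSoluble p G :=
  IsPSoluble.of_ker_of_card_le hp _ le_rfl f hf hker hH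

theorem isFittingClass_isPSoluble (hp : p.Prime) :
    IsFittingClass fun (G : Type u) [Group G] => IsPSoluble p G where
  of_subsingleton G _ _ := IsPSoluble.of_subsingleton p G
  congr e h := h.congr e
  of_normal N _ h := h.subgroup hp N
  sup A B _ _ hA hB := by
    refine IsPSoluble.of_ker hp (QuotientGroup.mk' (B.subgroupOf (A ⊔ B)))
      (QuotientGroup.mk'_surjective _) ?_ ?_
    · rw [QuotientGroup.ker_mk']
      exact hB.congr (Subgroup.subgroupOfEquivOfLe le_sup_right).symm
    · exact (hA.of_surjective hp _ (QuotientGroup.mk'_surjective (B.subgroupOf A))).congr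
        (QuotientGroup.quotientInfEquivProdNormalQuotient A B)

/-- The `p`-soluble radical as a functor. -/
def pSolubleRadicalFunctor (hp : p.Prime) : NormalFunctor.{u} where
  obj G := radical (fun (H : Type u) [Group H] => IsPSoluble p H) G
  normal G := radical_normal _ G
  map_le f hf := map_radical_le (𝔛 := fun (H : Type u) [Group H] => IsPSoluble p H)
    (fun _ _ _ _ f hf h => h.of_surjective hp f hf) f hf

theorem isPSoluble_pSolubleRadicalFunctor_obj (hp : p.Prime) (G : Type u) [Group G] [Finite G] :
    IsPSoluble p ((pSolubleRadicalFunctor hp).obj G) :=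
  (isFittingClass_isPSoluble hp).radical_mem

/-- The preimage of the radical of the quotient is an extension of `p`-soluble groups, hence already
lies in the radical of `G`. -/
theorem pSolubleRadicalFunctor_obj_eq_bot_of_ker (hp : p.Prime) {G H : Type u} [Group G] [Group H]
    [Finite G] (f : G →* H) (hf : Function.Surjective f)
    (hker : f.ker = (pSolubleRadicalFunctor hp).obj G) :
    (pSolubleRadicalFunctor hp).obj H = ⊥ := by
  have : Finite H := Finite.of_surjective f hf
  set R := (pSolubleRadicalFunctor hp).obj H
  have hk : IsPSoluble p (R.comap f) := by
    refine IsPSoluble.of_ker hp (f.subgroupComap R)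
      (f.subgroupComap_surjective_of_surjective R hf) ?_
      (isPSoluble_pSolubleRadicalFunctor_obj hp H)
    have h1 : (f.subgroupComap R).ker = f.ker.subgroupOf (R.comap f) := by
      ext x
      rw [MonoidHom.mem_ker, Subgroup.mem_subgroupOf, Subtype.ext_iff]
      rfl
    have h2 : f.ker ≤ R.comap f := fun x hx => by
      rw [Subgroup.mem_comap, MonoidHom.mem_ker.mp hx]
      exact one_mem _
    rw [h1]
    refine IsPSoluble.congr (Subgroup.subgroupOfEquivOfLe h2).symm ?_
    rw [hker]
    exact isPSoluble_pSolubleRadicalFunctor_obj hp G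
  have h3 : R.comap f ≤ f.ker := by
    rw [hker]
    exact le_radical (𝔛 := fun (H : Type u) [Group H] => IsPSoluble p H) inferInstance hk
  rw [← Subgroup.map_comap_eq_self_of_surjective hf R, Subgroup.map_eq_bot_iff]
  exact h3

end pSoluble

/-! ### Subnormal nonabelian simple subgroups -/

section simpleLayer

/-- The subgroup generated by all subnormal nonabelian simple subgroups. -/
def simpleLayer (G : Type u) [Group G] : Subgroup G :=
  sSup {L : Subgroup G | L.IsSubnormal ∧ IsSimpleGroup L ∧ ¬ IsMulCommutative L}

theorem not_isMulCommutative_congr {G H : Type u} [Group G] [Group H] (e : G ≃* H)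
    (h : ¬ IsMulCommutative G) : ¬ IsMulCommutative H := by
  rw [isMulCommutative_iff] at h ⊢
  exact fun hH => h fun a b => e.injective (by rw [map_mul, map_mul, hH])

variable {G : Type u} [Group G]

theorem map_simpleLayer_le {H : Type u} [Group H] (f : G →* H) (hf : Function.Surjective f) :
    (simpleLayer G).map f ≤ simpleLayer H := by
  rw [Subgroup.map_le_iff_le_comap]
  refine sSup_le fun L ⟨hL1, hL2, hL3⟩ => ?_
  rw [← Subgroup.map_le_iff_le_comap]
  rcases (MonoidHom.normal_ker (f.comp L.subtype)).eq_bot_or_eq_top with hb | ht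
  · let e : L ≃* L.map f := MulEquiv.ofBijective (f.subgroupMap L)
      ⟨fun x y hxy => (MonoidHom.ker_eq_bot_iff _).mp hb (congrArg Subtype.val hxy),
        f.subgroupMap_surjective L⟩
    exact le_sSup ⟨hL1.map hf, e.symm.isSimpleGroup, not_isMulCommutative_congr e hL3⟩
  · rintro _ ⟨x, hx, rfl⟩
    have h1 : (⟨x, hx⟩ : L) ∈ (f.comp L.subtype).ker := ht ▸ Subgroup.mem_top _
    have h2 : f x = 1 := h1
    rw [h2]
    exact one_mem _

instance simpleLayer_normal (G : Type u) [Group G] : (simpleLayer G).Normal :=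
  ⟨fun n hn g => map_simpleLayer_le (MulAut.conj g).toMonoidHom (MulAut.conj g).surjective
    ⟨n, hn, by simp⟩⟩

theorem map_subtype_simpleLayer_le {A : Subgroup G} (hA : A.IsSubnormal) :
    (simpleLayer A).map A.subtype ≤ simpleLayer G := by
  rw [Subgroup.map_le_iff_le_comap]
  refine sSup_le fun L ⟨hL1, hL2, hL3⟩ => ?_
  rw [← Subgroup.map_le_iff_le_comap]
  let e := L.equivMapOfInjective _ A.subtype_injective
  exact le_sSup ⟨hL1.trans' hA, e.symm.isSimpleGroup, not_isMulCommutative_congr e hL3⟩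

/-- The subgroup generated by all subnormal nonabelian simple subgroups, as a functor. -/
def simpleLayerFunctor : NormalFunctor.{u} where
  obj G := simpleLayer G
  normal _ := inferInstance
  map_le f hf := map_simpleLayer_le f hf

/-- Put `L` in a proper normal subgroup `N`. Either `K` commutes with `N`, or `K ≤ N` and induction
applies inside `N`. -/
theorem commutator_eq_bot_of_simple_of_card_le (n : ℕ) :
    ∀ {G : Type u} [Group G] [Finite G], Nat.card G ≤ n → ∀ {L K : Subgroup G},
      L.IsSubnormal → K.IsSubnormal → IsSimpleGroup L → IsSimpleGroup K →
      ¬ IsMulCommutative L → ¬ IsMulCommutative K → L ≠ K → ⁅L, K⁆ = ⊥ := by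
  induction n with
  | zero =>
    intro G _ _ hG
    exact absurd hG (not_le.mpr Nat.card_pos)
  | succ n ih =>
    intro G _ _ hG L K hL hK hLs hKs hLc hKc hne
    rcases hL.lt_normal with rfl | ⟨N, hN, hLN, hNlt⟩
    · have hGs : IsSimpleGroup G := Subgroup.topEquiv.symm.isSimpleGroup
      rcases hK.eq_bot_or_top_of_isSimpleGroup hGs with rfl | rfl
      · rw [Subgroup.commutator_bot_right]
      · exact absurd rfl hne
    · rcases (IsQuasisimple.of_isSimpleGroup hKc).le_or_commutator_eq_bot (N := N) hK
        (by rw [Subgroup.normalizer_eq_top]; exact le_top) with hKN | h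
      · have hcard : Nat.card N ≤ n := by
          have h1 : Nat.card N < Nat.card G := by
            refine lt_of_le_of_ne (Subgroup.card_le_card_group N) fun h => hNlt.ne ?_
            exact Subgroup.eq_top_of_card_eq N h
          omega
        let eL := (Subgroup.subgroupOfEquivOfLe hLN).symm
        let eK := (Subgroup.subgroupOfEquivOfLe hKN).symm
        have h1 := ih hcard (L := L.subgroupOf N) (K := K.subgroupOf N) hL.subgroupOf
          hK.subgroupOf eL.symm.isSimpleGroup eK.symm.isSimpleGroup
          (not_isMulCommutative_congr eL hLc) (not_isMulCommutative_congr eK hKc) fun h => hne (by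
            rw [← Subgroup.map_subgroupOf_eq_of_le hLN, h, Subgroup.map_subgroupOf_eq_of_le hKN])
        rw [← Subgroup.map_subgroupOf_eq_of_le hLN, ← Subgroup.map_subgroupOf_eq_of_le hKN,
          ← Subgroup.map_commutator, h1, Subgroup.map_bot]
      · rw [eq_bot_iff, ← h]
        exact Subgroup.commutator_mono hLN le_rfl

theorem isDirectProductOfNonabelianSimple_simpleLayer [Finite G] (h : simpleLayer G ≠ ⊥) :
    IsDirectProductOfNonabelianSimple (simpleLayer G) := by
  classical
  let ι := {L : Subgroup G // L.IsSubnormal ∧ IsSimpleGroup L ∧ ¬ IsMulCommutative L}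
  have hfin : Finite ι := inferInstance
  obtain ⟨n, ⟨ε⟩⟩ := Finite.exists_equiv_fin ι
  let S : Fin n → Subgroup G := fun i => (ε.symm i).1
  have hS : ∀ i, (S i).IsSubnormal ∧ IsSimpleGroup (S i) ∧ ¬ IsMulCommutative (S i) :=
    fun i => (ε.symm i).2
  have hsup : ⨆ i, S i = simpleLayer G := by
    refine le_antisymm (iSup_le fun i => le_sSup (hS i)) (sSup_le fun L hL => ?_)
    have h1 := le_iSup S (ε ⟨L, hL⟩)
    simpa [S] using h1
  have hbot : Pairwise fun i j => ⁅S i, S j⁆ = ⊥ := fun i j hij =>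
    commutator_eq_bot_of_simple_of_card_le _ le_rfl (hS i).1 (hS j).1 (hS i).2.1 (hS j).2.1
      (hS i).2.2 (hS j).2.2 fun h => hij (ε.symm.injective (Subtype.ext h))
  have hcomm : Pairwise fun i j => ∀ x y : G, x ∈ S i → y ∈ S j → Commute x y := by
    intro i j hij x y hx hy
    exact (Subgroup.mem_centralizer_iff.mp
      (Subgroup.commutator_eq_bot_iff_le_centralizer.mp (hbot hij) hx) y hy).symm
  -- An element of `S i` that is also in the join of the other factors centralizes `S i`, so it lies
  -- in the trivial centre.
  have hind : iSupIndep S := by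
    intro i
    rw [disjoint_iff, eq_bot_iff]
    rintro x ⟨hx, hx'⟩
    have h1 : ⨆ j, ⨆ (_ : j ≠ i), S j ≤ Subgroup.centralizer (S i) :=
      iSup₂_le fun j hj => Subgroup.commutator_eq_bot_iff_le_centralizer.mp (hbot hj)
    have h2 : (⟨x, hx⟩ : S i) ∈ Subgroup.center (S i) := by
      rw [Subgroup.mem_center_iff]
      exact fun y => Subtype.ext (Subgroup.mem_centralizer_iff.mp (h1 hx') y y.2)
    have := (hS i).2.1
    have h3 : Subgroup.center (S i) = ⊥ := by
      refine (Subgroup.Normal.eq_bot_or_eq_top inferInstance).resolve_right fun ht => (hS i).2.2 ?_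
      rw [isMulCommutative_iff]
      exact fun a b => Subgroup.mem_center_iff.mp (ht ▸ Subgroup.mem_top b) a
    rw [h3, Subgroup.mem_bot] at h2
    exact congrArg Subtype.val h2
  have hn : 0 < n := by
    rcases Nat.eq_zero_or_pos n with rfl | h0
    · exact absurd (by rw [← hsup, iSup_of_empty]) h
    · exact h0
  let F := Subgroup.noncommPiCoprod hcomm
  have hF : Function.Injective F := Subgroup.injective_noncommPiCoprod_of_iSupIndep hind
  have hFr : F.range = simpleLayer G := by
    rw [← hsup]
    exact Subgroup.noncommPiCoprod_range
  exact ⟨n, fun i => S i, fun _ => inferInstance, hn, fun i => (hS i).2,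
    ⟨((MonoidHom.ofInjective hF).trans (MulEquiv.subgroupCongr hFr)).symm⟩⟩

theorem IsDirectProductOfNonabelianSimple.simpleLayer_eq_top
    (h : IsDirectProductOfNonabelianSimple G) : simpleLayer G = ⊤ := by
  classical
  obtain ⟨n, S, _, _, hS, ⟨e⟩⟩ := h
  have h1 : simpleLayer (∀ i, S i) = ⊤ := by
    rw [eq_top_iff]
    intro x _
    refine Subgroup.pi_mem_of_mulSingle_mem x fun i => ?_
    let j : S i →* (∀ i, S i) := MonoidHom.mulSingle S i
    have hj : Function.Injective j := Pi.mulSingle_injective (M := S) i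
    have hnorm : j.range.Normal := by
      refine ⟨?_⟩
      rintro _ ⟨t, rfl⟩ x
      refine ⟨x i * t * (x i)⁻¹, ?_⟩
      funext k
      by_cases hk : k = i
      · subst hk; simp [j]
      · simp [j, Pi.mulSingle_eq_of_ne hk]
    have := (hS i).1
    let e' := MonoidHom.ofInjective hj
    have h2 : j.range ≤ simpleLayer (∀ i, S i) :=
      le_sSup ⟨hnorm.isSubnormal, e'.symm.isSimpleGroup, not_isMulCommutative_congr e' (hS i).2⟩
    exact h2 ⟨x i, rfl⟩
  rw [eq_top_iff, ← Subgroup.map_top_of_surjective e.symm.toMonoidHom e.symm.surjective, ← h1]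
  exact map_simpleLayer_le _ e.symm.surjective

theorem IsDirectProductOfNonabelianSimple.le_simpleLayer {D : Type u} [Group D]
    (h : IsDirectProductOfNonabelianSimple D) {P : Subgroup G} (hP : P.IsSubnormal) (f : D →* P)
    (hf : Function.Surjective f) : P ≤ simpleLayer G := by
  have h1 : simpleLayer P = ⊤ := by
    rw [eq_top_iff, ← Subgroup.map_top_of_surjective f hf, ← h.simpleLayer_eq_top]
    exact map_simpleLayer_le f hf
  have h2 := map_subtype_simpleLayer_le hP
  rwa [h1, ← MonoidHom.range_eq_map, Subgroup.range_subtype] at h2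

variable {p : ℕ}

/-- In a group with trivial `p`-soluble radical, the subnormal nonabelian simple subgroups
generate a subgroup with trivial centralizer. -/
theorem centralizer_simpleLayer_eq_bot [Finite G] (hp : p.Prime)
    (hG : (pSolubleRadicalFunctor hp).obj G = ⊥) :
    Subgroup.centralizer (simpleLayer G : Set G) = ⊥ := by
  set C := Subgroup.centralizer (simpleLayer G : Set G) with hC
  have hCn : C.Normal := inferInstance
  by_contra hne
  have : Nontrivial C := (Subgroup.nontrivial_iff_ne_bot C).mpr hne
  -- If `T` is abelian, `N` is `p`-soluble and falls into the trivial radical. Otherwise `T` is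
  -- subnormal in `G`, so it lies in the simple layer and also centralizes it, which makes it
  -- abelian.
  obtain ⟨N, T, n, hN, hT, hs, hn, ⟨e⟩⟩ := exists_normal_mulEquiv_pi C
  by_cases hc : IsMulCommutative T
  · have hsol : IsPSoluble p N := by
      refine IsPSoluble.of_card ?_
      have hq : (Nat.card T).Prime := Group.is_simple_iff_prime_card.mp hs
      rw [Nat.card_congr e.toEquiv, Nat.card_fun, Nat.card_fin]
      by_cases hpq : p = Nat.card T
      · exact Or.inl ⟨n, by rw [hpq]⟩
      · exact Or.inr fun hd => hpq ((Nat.prime_dvd_prime_iff_eq hp hq).mp (hp.dvd_of_dvd_pow hd))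
    have h1 : N.map C.subtype ≤ ⊥ := by
      rw [← hG]
      exact (Subgroup.map_mono (le_radical hN hsol)).trans
        ((isFittingClass_isPSoluble hp).map_radical_subtype_le C)
    rw [le_bot_iff, Subgroup.map_eq_bot_iff_of_injective _ C.subtype_injective] at h1
    subst h1
    exact not_subsingleton T inferInstance
  · have h1 : (T.map N.subtype).map C.subtype ≤ simpleLayer G := by
      refine (Subgroup.map_mono ((Subgroup.map_mono ?_).trans
        (map_subtype_simpleLayer_le hN.isSubnormal))).trans
        (map_subtype_simpleLayer_le hCn.isSubnormal)
      exact le_sSup ⟨hT.isSubnormal, hs, hc⟩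
    refine hc (isMulCommutative_iff.mpr fun a b => ?_)
    have h2 := Subgroup.mem_centralizer_iff.mp (b : N).1.2 _ (h1 ⟨_, ⟨a, a.2, rfl⟩, rfl⟩)
    exact Subtype.ext (Subtype.ext (Subtype.ext h2))

theorem simpleLayer_eq_comap {Y : Type u} [Group Y] [Finite G] (hp : p.Prime)
    (hG : (pSolubleRadicalFunctor hp).obj G = ⊥) (ι : Y →* G) (hι : Function.Injective ι)
    (hle : simpleLayer G ≤ ι.range) : simpleLayer Y = (simpleLayer G).comap ι := by
  have hmap : ∀ N : Subgroup G, N ≤ simpleLayer G → N = (N.comap ι).map ι := fun N hN =>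
    (Subgroup.map_comap_eq_self (hN.trans hle)).symm
  refine le_antisymm (sSup_le fun L ⟨hL1, hL2, hL3⟩ => ?_) ?_
  · set N := (simpleLayer G).comap ι with hN
    have hnn : N.Normal := inferInstance
    rcases (IsQuasisimple.of_isSimpleGroup hL3).le_or_commutator_eq_bot (N := N) hL1
      (by rw [Subgroup.normalizer_eq_top]; exact le_top) with h | h
    · exact h
    · rw [← Subgroup.map_le_iff_le_comap]
      refine le_trans ?_ bot_le
      rw [← centralizer_simpleLayer_eq_bot hp hG]
      rw [Subgroup.commutator_comm] at h
      rw [← Subgroup.commutator_eq_bot_iff_le_centralizer, hmap _ le_rfl, ← Subgroup.map_commutator,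
        h, Subgroup.map_bot]
  · rw [← Subgroup.comap_map_eq_self_of_injective hι (simpleLayer Y)]
    refine Subgroup.comap_mono (sSup_le fun K hK => ?_)
    rw [hmap K (le_sSup hK)]
    refine Subgroup.map_mono ?_
    let e := (MulEquiv.subgroupCongr (hmap K (le_sSup hK))).trans
        ((K.comap ι).equivMapOfInjective ι hι).symm
    have := hK.2.1
    exact le_sSup ⟨hK.1.comap ι, e.symm.isSimpleGroup, not_isMulCommutative_congr e hK.2.2⟩

end simpleLayer

/-! ### The alternating series and the bound for `λ_p` -/

section nonPSolubleLength

variable {p : ℕ}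

/-- The `p`-soluble radical for even `i` and the functor `simpleLayerFunctor` for odd `i`. -/
def alternatingFunctor (hp : p.Prime) (i : ℕ) : NormalFunctor.{u} :=
  if Even i then pSolubleRadicalFunctor hp else simpleLayerFunctor

theorem alternatingFunctor_of_even (hp : p.Prime) {i : ℕ} (hi : Even i) :
    alternatingFunctor.{u} hp i = pSolubleRadicalFunctor hp := if_pos hi

theorem alternatingFunctor_of_odd (hp : p.Prime) {i : ℕ} (hi : Odd i) :
    alternatingFunctor.{u} hp i = simpleLayerFunctor := if_neg (Nat.not_even_iff_odd.mpr hi)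

theorem alternatingFunctor_add_two (hp : p.Prime) (i : ℕ) :
    alternatingFunctor.{u} hp (i + 2) = alternatingFunctor hp i := by
  simp [alternatingFunctor, Nat.even_add]

variable {G : Type u} [Group G]

theorem nonempty_series_factor_mulEquiv (ρ : ℕ → NormalFunctor.{u}) (i : ℕ) :
    Nonempty (series ρ G (i + 1) ⧸ (series ρ G i).subgroupOf (series ρ G (i + 1)) ≃*
      (ρ i).obj (G ⧸ series ρ G i)) := by
  let π := QuotientGroup.mk' (series ρ G i)
  let φ : series ρ G (i + 1) →* (ρ i).obj (G ⧸ series ρ G i) :=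
    π.subgroupComap ((ρ i).obj (G ⧸ series ρ G i))
  have hker : (series ρ G i).subgroupOf (series ρ G (i + 1)) = φ.ker := by
    ext x
    rw [MonoidHom.mem_ker, Subgroup.mem_subgroupOf, Subtype.ext_iff]
    exact (QuotientGroup.eq_one_iff (x : G)).symm
  exact ⟨(QuotientGroup.quotientMulEquivOfEq hker).trans
    (QuotientGroup.quotientKerEquivOfSurjective φ
      (π.subgroupComap_surjective_of_surjective _ (QuotientGroup.mk'_surjective _)))⟩

theorem pSolubleRadicalFunctor_obj_quotient_series (hp : p.Prime) [Finite G] {i : ℕ}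
    (hi : Odd i) :
    (pSolubleRadicalFunctor hp).obj (G ⧸ series (alternatingFunctor hp) G i) = ⊥ := by
  obtain ⟨k, rfl⟩ : ∃ k, i = k + 1 := ⟨i - 1, by have := hi.pos; omega⟩
  have hk : Even k := by
    rw [Nat.odd_add_one] at hi
    exact Nat.not_odd_iff_even.mp hi
  have hle := series_monotone (alternatingFunctor hp) G (Nat.le_succ k)
  let f := QuotientGroup.map (series (alternatingFunctor hp) G k)
    (series (alternatingFunctor hp) G (k + 1)) (MonoidHom.id G) hle
  refine pSolubleRadicalFunctor_obj_eq_bot_of_ker hp f ?_ ?_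
  · intro y
    obtain ⟨y, rfl⟩ := QuotientGroup.mk'_surjective _ y
    exact ⟨QuotientGroup.mk y, rfl⟩
  · rw [← alternatingFunctor_of_even hp hk]
    ext x
    obtain ⟨x, rfl⟩ := QuotientGroup.mk'_surjective _ x
    exact QuotientGroup.eq_one_iff x

/-- The alternating series ascends at least as fast as any admissible series: each factor of the
latter maps onto a normal subgroup inside the corresponding functor. -/
theorem alternating_series_eq_top (hp : p.Prime) [Finite G] {h : ℕ} (hG : HasNonPSolubleSeries p G h) :
    series (alternatingFunctor hp) G (2 * h + 1) = ⊤ := by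
  obtain ⟨N, hN, hmono, hN0, hNtop, hfac⟩ := hG
  have key : ∀ i ≤ 2 * h + 1, N i ≤ series (alternatingFunctor hp) G i := by
    intro i
    induction i with
    | zero => exact fun _ => hN0.le.trans bot_le
    | succ i ih =>
      intro hi
      have hNi := ih (by omega)
      have := hN (i + 1)
      let π := QuotientGroup.mk' (series (alternatingFunctor hp) G i)
      have hP : ((N (i + 1)).map π).Normal := (hN _).map π (QuotientGroup.mk'_surjective _)
      let f : N (i + 1) ⧸ (N i).subgroupOf (N (i + 1)) →* (N (i + 1)).map π :=
        QuotientGroup.lift _ (π.subgroupMap (N (i + 1))) fun x hx =>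
          Subtype.ext ((QuotientGroup.eq_one_iff (x : G)).mpr (hNi hx))
      have hf : Function.Surjective f :=
        QuotientGroup.lift_surjective_of_surjective _ _ (π.subgroupMap_surjective _) _
      rw [series_succ, ← Subgroup.map_le_iff_le_comap]
      rcases Nat.even_or_odd i with he | ho
      · rw [alternatingFunctor_of_even hp he]
        exact le_radical (𝔛 := fun (H : Type u) [Group H] => IsPSoluble p H) hP
          (((hfac i (by omega)).1 he).of_surjective hp f hf)
      · rw [alternatingFunctor_of_odd hp ho]
        exact ((hfac i (by omega)).2 ho).le_simpleLayer hP.isSubnormal f hf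
  exact top_le_iff.mp (hNtop ▸ key _ le_rfl)

theorem nonPSolubleLength_le (hp : p.Prime) [Finite G] {h : ℕ}
    (hG : series (alternatingFunctor hp) G (2 * h + 1) = ⊤) : nonPSolubleLength p G ≤ h := by
  classical
  have hex : ∃ h, series (alternatingFunctor hp) G (2 * h + 1) = ⊤ := ⟨h, hG⟩
  -- The least `k` is used because the odd factors must be nontrivial. A trivial simple layer has
  -- the whole quotient as its centralizer, so that quotient is trivial and the series would have
  -- ended at a smaller index.
  refine le_trans (Nat.sInf_le ?_) (Nat.find_min' hex hG)
  set k := Nat.find hex with hk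
  refine ⟨series (alternatingFunctor hp) G, fun _ => inferInstance, series_monotone _ _, rfl,
    Nat.find_spec hex, fun i hi => ⟨fun he => ?_, fun ho => ?_⟩⟩
  · obtain ⟨e⟩ := nonempty_series_factor_mulEquiv (G := G) (alternatingFunctor hp) i
    refine IsPSoluble.congr e.symm ?_
    rw [alternatingFunctor_of_even hp he]
    exact isPSoluble_pSolubleRadicalFunctor_obj hp _
  · obtain ⟨e⟩ := nonempty_series_factor_mulEquiv (G := G) (alternatingFunctor hp) i
    refine IsDirectProductOfNonabelianSimple.congr e.symm ?_
    rw [alternatingFunctor_of_odd hp ho]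
    refine isDirectProductOfNonabelianSimple_simpleLayer fun hbot => ?_
    have h1 := centralizer_simpleLayer_eq_bot hp
      (pSolubleRadicalFunctor_obj_quotient_series (G := G) hp ho)
    rw [hbot, Subgroup.centralizer_eq_top_iff_subset.mpr (by simp)] at h1
    obtain ⟨t, rfl⟩ := ho
    refine Nat.find_min hex (m := t) (by omega) ?_
    by_contra hne
    have := QuotientGroup.nontrivial_iff.mpr hne
    exact top_ne_bot h1

theorem nonPSolubleLength_le_add_one (hp : p.Prime) [Finite G]
    {M : Subgroup G} (hM : IsCoatom M) :
    nonPSolubleLength p G ≤ nonPSolubleLength p M + 1 := by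
  refine nonPSolubleLength_le hp ?_
  refine series_add_two_eq_top (alternatingFunctor_add_two hp) hM
    ⟨_, alternating_series_eq_top hp (hasNonPSolubleSeries_nonPSolubleLength hp G)⟩ ?_
    (alternating_series_eq_top hp (hasNonPSolubleSeries_nonPSolubleLength hp M))
  refine series_eq_comap fun k Y _ ι hι A hAn hA hF hAF => ?_
  rcases Nat.even_or_odd k with he | ho
  -- At an even index the next factor is a simple layer over a trivial `p`-soluble radical, hence
  -- self-centralizing. At an odd index the simple layer itself has trivial centralizer, and `hAF`
  -- is not needed.
  · have hself := hAF (by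
      rw [alternatingFunctor_of_odd hp he.add_one]
      exact (centralizer_simpleLayer_eq_bot hp
        (pSolubleRadicalFunctor_obj_quotient_series hp he.add_one)).le.trans bot_le)
    rw [alternatingFunctor_of_even hp he] at hF hself ⊢
    refine le_antisymm ?_ ?_
    · rw [← Subgroup.map_le_iff_le_comap]
      exact (isFittingClass_isPSoluble hp).map_radical_le_of_self_centralizing ι hι hA le_rfl hself
    · refine le_radical (𝔛 := fun (H : Type u) [Group H] => IsPSoluble p H) inferInstance ?_
      have h1 := (Subgroup.map_comap_eq_self (hF.trans hA)).symm
      exact (isPSoluble_pSolubleRadicalFunctor_obj hp _).congr ((MulEquiv.subgroupCongr h1).trans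
        (Subgroup.equivMapOfInjective _ ι hι).symm)
  · rw [alternatingFunctor_of_odd hp ho] at hF ⊢
    exact simpleLayer_eq_comap hp (pSolubleRadicalFunctor_obj_quotient_series hp ho) ι hι
      (hF.trans hA)

end nonPSolubleLength

theorem generalizedFittingHeight_le_add_two {G : Type u} [Group G] [Finite G] {M : Subgroup G}
    (hM : IsCoatom M) : generalizedFittingHeight G ≤ generalizedFittingHeight M + 2 :=
  Nat.sInf_le (generalizedFittingSeries_add_two_eq_top hM
    (generalizedFittingSeries_generalizedFittingHeight M))

end GroupLength

theorem mainTheorem1 {G : Type*} [Group G] [Finite G] (M : Subgroup G) (hM : IsCoatom M)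
    (p : ℕ) (hp : p.Prime) :
    (GroupLength.generalizedFittingHeight G : ℤ) - GroupLength.generalizedFittingHeight M ≤ 2 ∧
    (GroupLength.nonsolubleLength G : ℤ) - GroupLength.nonsolubleLength M ≤ 1 ∧
    (GroupLength.nonPSolubleLength p G : ℤ) - GroupLength.nonPSolubleLength p M ≤ 1 := by
  have h1 := GroupLength.generalizedFittingHeight_le_add_two hM
  have h2 : GroupLength.nonsolubleLength G ≤ GroupLength.nonsolubleLength M + 1 :=
    GroupLength.nonPSolubleLength_le_add_one Nat.prime_two hM
  have h3 := GroupLength.nonPSolubleLength_le_add_one hp hM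
  omega
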